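/- **Conventions.** A *groupoid* is a set $G$ with a set $G^{(2)}\subseteq G\times G$ of composable pairs, an associative partial product $G^{(2)}\to G$ and an inversion $g\mapsto g^{-1}$ such that $(g,g^{-1})\in G^{(2)}$ for all $g$, and $g^{-1}(gh)=h$, $(gh)h^{-1}=g$ for all $(g,h)\in G^{(2)}$. Its unit space is $G^{(0)}=\{gg^{-1}\mid g\in G\}$, and $r(g)=gg^{-1}$, $d(g)=g^{-1}g$. Let $G$ be a *locally compact Hausdorff étale groupoid*: $G$ carries a locally compact Hausdorff topology for which product and inversion are continuous and which has a basis of open bisections, that is, of open sets $S$ such that $r|_S$ and $d|_S$ are homeomorphisms onto open subsets of $G^{(0)}$. Write $G_u=d^{-1}(u)$ and $G^u=r^{-1}(u)$ for $u\in G^{(0)}$. A set $D\subseteq G^{(0)}$ is *invariant* if $d(g)\in D$ implies $r(g)\in D$ for all $g\in G$; then $G_D=\{g\mid d(g)\in D\}$ is a subgroupoid with unit space $D$, and it is again locally compact Hausdorff étale if $D$ is open or closed. The space $C_c(G)$ of compactly supported continuous functions $G\to\mathbb{C}$ is a $*$-algebra under $$(f_1*f_2)(g)=\sum_{h\in G^{r(g)}}f_1(h)f_2(h^{-1}g),\qquad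 f^*(g)=\overline{f(g^{-1})}.$$ For $u\in G^{(0)}$ let $\pi_u:C_c(G)\to B(\ell^2(G_u))$, $\pi_u(f)\xi=f*\xi$. The *reduced $C^*$-algebra* $C_r^*(G)$ is the completion of $C_c(G)$ in the norm $\|f\|_r=\sup_{u}\|\pi_u(f)\|$. Extension of functions by zero from $G^{(0)}$ to $G$ induces an embedding $C_0(G^{(0)})\hookrightarrow C_r^*(G)$, and we regard $C_0(G^{(0)})$ as a subalgebra of $C_r^*(G)$. For a $C^*$-algebra $A$ let $\mathcal{I}(A)$ be the lattice of closed two-sided ideals of $A$ (meet $I\cap J$, join $I+J$), with the *Fell topology*, for which the sets $\{J\in\mathcal{I}(A)\mid I\not\subseteq J\}$, $I\in\mathcal{I}(A)$, form a subbase. Let $\mathcal{O}(G^{(0)})$ be the lattice of open invariant subsets of $G^{(0)}$ (meet $\cap$, join $\cup$), with the topology induced from $\mathcal{I}(C_0(G^{(0)}))$ through $U\mapsto C_0(U)$. For $I\in\mathcal{I}(C_r^*(G))$ the set $$U_I=\bigcup_{f\in I\cap C_0(G^{(0)})}f^{-1}(\mathbb{C}\setminus\{0\})$$ is open and invariant,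 so that $\Theta(I)=U_I$ defines a map $\Theta:\mathcal{I}(C_r^*(G))\to\mathcal{O}(G^{(0)})$. * $C_0(G^{(0)})$ *separates the ideals* of $C_r^*(G)$ if $\Theta$ is injective. * $G$ is *inner exact* if, for every closed invariant $D\subseteq G^{(0)}$, the sequence $$0\to C_r^*(G_{G^{(0)}\setminus D})\to C_r^*(G)\to C_r^*(G_D)\to 0$$ is exact, where the first map is induced by extending functions on the open subgroupoid $G_{G^{(0)}\setminus D}$ by zero, and the second by restricting functions to the closed subgroupoid $G_D$. * $G$ has the *intersection property* if $I\cap C_0(G^{(0)})\neq\{0\}$ for every non-zero $I\in\mathcal{I}(C_r^*(G))$, and the *residual intersection property* if $G_D$ has the intersection property for every closed invariant $D\subseteq G^{(0)}$. **Theorem.** Let $G$ be a locally compact Hausdorff étale groupoid. The following are equivalent: 1. $\Theta:\mathcal{I}(C_r^*(G))\to\mathcal{O}(G^{(0)})$ is a bijection. 2. $C_0(G^{(0)})$ separates the ideals of $C_r^*(G)$. 3. $G$ is inner exact and has the residual intersection property. If these conditions hold, then $\Theta$ is an isomorphism of lattices and a homeomorphism. -/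

import Mathlib

open Set Topology Filter
open scoped CompactlySupported ZeroAtInfty ENNReal lp

universe u

/-- A groupoid: a set `G` with a set of composable pairs, a product defined on it and an inversion.
Everything that the axioms assert to be composable is asserted to be so explicitly. -/
class GroupoidSet (G : Type u) where
  Comp : G → G → Prop
  mul : ∀ g h : G, Comp g h → G
  inv : G → G
  assoc : ∀ (g₁ g₂ g₃ : G) (h₁₂ : Comp g₁ g₂) (h₂₃ : Comp g₂ g₃),
    ∃ (h : Comp (mul g₁ g₂ h₁₂) g₃) (h' : Comp g₁ (mul g₂ g₃ h₂₃)),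
      mul (mul g₁ g₂ h₁₂) g₃ h = mul g₁ (mul g₂ g₃ h₂₃) h'
  comp_inv : ∀ g : G, Comp g (inv g)
  inv_mul_cancel : ∀ (g h : G) (c : Comp g h),
    ∃ c' : Comp (inv g) (mul g h c), mul (inv g) (mul g h c) c' = h
  mul_inv_cancel : ∀ (g h : G) (c : Comp g h),
    ∃ c' : Comp (mul g h c) (inv h), mul (mul g h c) (inv h) c' = g

namespace GroupoidSet

section Algebra

variable {G : Type u} [GroupoidSet G]

lemma mul_congr {g g' h h' : G} (eg : g = g') (eh : h = h') (c : Comp g h) (c' : Comp g' h') :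
    mul g h c = mul g' h' c' := by
  subst eg; subst eh; rfl

lemma inv_inv (g : G) : inv (inv g) = g := by
  obtain ⟨c1, e1⟩ := mul_inv_cancel g (inv g) (comp_inv g)
  obtain ⟨h, h', e2⟩ := assoc g (inv g) (inv (inv g)) (comp_inv g) (comp_inv (inv g))
  have e3 : mul g (mul (inv g) (inv (inv g)) (comp_inv _)) h' = g := e2.symm.trans e1
  obtain ⟨c4, e4⟩ := inv_mul_cancel _ _ h'
  have c5 : Comp (inv g) g := by rw [e3] at c4; exact c4
  have e5 : mul (inv g) g c5 = mul (inv g) (inv (inv g)) (comp_inv _) :=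
    (mul_congr rfl e3.symm c5 c4).trans e4
  obtain ⟨c6, e6⟩ := inv_mul_cancel _ _ c5
  obtain ⟨c7, e7⟩ := inv_mul_cancel _ _ (comp_inv (inv g))
  exact e7.symm.trans ((mul_congr rfl e5.symm c7 c6).trans e6)

lemma inv_comp (g : G) : Comp (inv g) g := by
  have := comp_inv (inv g); rwa [inv_inv] at this

variable (G) in
/-- The set of units. -/
def unitSet : Set G := {x | ∃ g : G, mul g (inv g) (comp_inv g) = x}

variable (G) in
/-- The unit space `G⁽⁰⁾`. -/
abbrev UnitSpace : Type u := ↥(unitSet G)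

/-- The range map `r(g) = g g⁻¹`. -/
def r (g : G) : UnitSpace G := ⟨mul g (inv g) (comp_inv g), g, rfl⟩

/-- The domain map `d(g) = g⁻¹ g`. -/
def d (g : G) : UnitSpace G :=
  ⟨mul (inv g) g (inv_comp g), inv g, mul_congr rfl (inv_inv g) _ _⟩

lemma r_coe (g : G) : (r g : G) = mul g (inv g) (comp_inv g) := rfl
lemma d_coe (g : G) : (d g : G) = mul (inv g) g (inv_comp g) := rfl

lemma r_inv (g : G) : r (inv g) = d g := Subtype.ext (mul_congr rfl (inv_inv g) _ _)
lemma d_inv (g : G) : d (inv g) = r g := Subtype.ext (mul_congr (inv_inv g) rfl _ _)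

lemma comp_iff {g h : G} : Comp g h ↔ d g = r h := by
  constructor
  · intro c
    obtain ⟨c1, c2, e⟩ := assoc _ _ _ (inv_comp g) c
    obtain ⟨c3, e3⟩ := inv_mul_cancel g h c
    obtain ⟨c4, e4⟩ := mul_inv_cancel _ _ c1
    apply Subtype.ext
    rw [d_coe, r_coe, ← e4]
    exact mul_congr (e.trans e3) rfl _ _
  · intro e
    have e' : mul (inv g) g (inv_comp g) = mul h (inv h) (comp_inv h) := congrArg Subtype.val e
    obtain ⟨c1, c2, e1⟩ := assoc _ _ _ (comp_inv g) (inv_comp g)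
    obtain ⟨c3, c4, e3⟩ := assoc _ _ _ (comp_inv h) (inv_comp h)
    obtain ⟨c5, e5⟩ := mul_inv_cancel g (inv g) (comp_inv g)
    have eg : mul g _ c2 = g := by
      exact e1.symm.trans ((mul_congr rfl (inv_inv g).symm c1 c5).trans e5)
    have c6 : Comp (mul (inv g) g (inv_comp g)) h := by rw [e']; exact c3
    obtain ⟨c7, c8, e7⟩ := assoc _ _ _ c2 c6
    rw [eg] at c7
    exact c7

lemma Comp.eq {g h : G} (c : Comp g h) : d g = r h := comp_iff.1 c

lemma r_mul (g h : G) (c : Comp g h) : r (mul g h c) = r g := by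
  obtain ⟨c1, c2, e⟩ := assoc _ _ _ (inv_comp g) c
  rw [← d_inv g, comp_iff.1 c2]

lemma d_mul (g h : G) (c : Comp g h) : d (mul g h c) = d h := by
  obtain ⟨c1, c2, e⟩ := assoc _ _ _ c (comp_inv h)
  rw [comp_iff.1 c1, r_inv]

lemma r_coe_unit (x : UnitSpace G) : r (x : G) = x := by
  obtain ⟨x, g, rfl⟩ := x
  rw [r_mul]; rfl

lemma d_coe_unit (x : UnitSpace G) : d (x : G) = x := by
  obtain ⟨x, g, rfl⟩ := x
  rw [d_mul, d_inv]; rfl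

lemma mul_inv_cancel' (g h : G) (c : Comp g h) (c') : mul (mul g h c) (inv h) c' = g :=
  (mul_inv_cancel g h c).2

lemma inv_mul_cancel' (g h : G) (c : Comp g h) (c') : mul (inv g) (mul g h c) c' = h :=
  (inv_mul_cancel g h c).2

lemma mul_inv_mul (g h : G) (c : Comp g (inv h)) (c') : mul (mul g (inv h) c) h c' = g := by
  have c1 : Comp (mul g (inv h) c) (inv (inv h)) := by rw [inv_inv]; exact c'
  exact (mul_congr rfl (inv_inv h).symm c' c1).trans (mul_inv_cancel' g (inv h) c c1)

lemma mul_inv_mul_left (g h : G) (c : Comp (inv g) h) (c') : mul g (mul (inv g) h c) c' = h := by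
  have c1 : Comp (inv (inv g)) (mul (inv g) h c) := by rw [inv_inv]; exact c'
  exact (mul_congr (inv_inv g).symm rfl c' c1).trans (inv_mul_cancel' (inv g) h c c1)

lemma mul_assoc' (g₁ g₂ g₃ : G) (c c' e e') :
    mul (mul g₁ g₂ c) g₃ c' = mul g₁ (mul g₂ g₃ e) e' := (assoc g₁ g₂ g₃ c e).2.2

lemma coe_r_mul (g : G) (c) : mul (r g : G) g c = g :=
  mul_inv_mul g g (comp_inv g) c

lemma mul_coe_d (g : G) (c) : mul g (d g : G) c = g :=
  mul_inv_mul_left g g (inv_comp g) c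

lemma mul_left_cancel {g h h' : G} {c c'} (e : mul g h c = mul g h' c') : h = h' := by
  rw [← inv_mul_cancel' g h c (inv_mul_cancel g h c).1,
    ← inv_mul_cancel' g h' c' (inv_mul_cancel g h' c').1]
  exact mul_congr rfl e _ _

lemma mul_right_cancel {g g' h : G} {c c'} (e : mul g h c = mul g' h c') : g = g' := by
  rw [← mul_inv_cancel' g h c (mul_inv_cancel g h c).1,
    ← mul_inv_cancel' g' h c' (mul_inv_cancel g' h c').1]
  exact mul_congr e rfl _ _

lemma inv_mul_rev (g h : G) (c : Comp g h) (c' : Comp (inv h) (inv g)) :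
    inv (mul g h c) = mul (inv h) (inv g) c' := by
  have c1 : Comp (mul g h c) (mul (inv h) (inv g) c') := by
    rw [comp_iff, d_mul, r_mul, r_inv]
  apply mul_left_cancel (g := mul g h c) (c := comp_inv _) (c' := c1)
  rw [← mul_assoc' (mul g h c) (inv h) (inv g) (mul_inv_cancel g h c).1
    (by rw [mul_inv_cancel']; exact comp_inv g)]
  rw [← r_coe, r_mul, r_coe]
  exact mul_congr (by rw [mul_inv_cancel']) rfl _ _

variable {u : UnitSpace G}

/-- The fibre `G_u = {g | d(g) = u}`. -/
abbrev Fib (u : UnitSpace G) : Type u := {g : G // d g = u}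

lemma comp_div (g k : Fib u) : Comp g.1 (inv k.1) := by rw [comp_iff, r_inv, g.2, k.2]

/-- The product `g k⁻¹` of two elements of a fibre `G_u`. -/
def div (g k : Fib u) : G := mul g.1 (inv k.1) (comp_div g k)

lemma r_div (g k : Fib u) : r (div g k) = r g.1 := r_mul _ _ _
lemma d_div (g k : Fib u) : d (div g k) = r k.1 := by rw [div, d_mul, d_inv]

lemma div_left_inj {g g' k : Fib u} (e : div g k = div g' k) : g = g' :=
  Subtype.ext (mul_right_cancel e)

lemma div_right_inj {g k k' : Fib u} (e : div g k = div g k') : k = k' := by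
  have := mul_left_cancel e
  apply Subtype.ext
  rw [← inv_inv k.1, this, inv_inv]

lemma inv_div (g k : Fib u) : inv (div g k) = div k g := by
  unfold div
  rw [inv_mul_rev _ _ _ (by rw [inv_inv]; exact comp_div k g)]
  exact mul_congr (inv_inv _) rfl _ _

lemma div_mul (g k : Fib u) (c) : mul (div g k) k.1 c = g.1 := mul_inv_mul _ _ _ _

lemma div_mul_div (g j k : Fib u) (c) : mul (div g j) (div j k) c = div g k := by
  have c2 : Comp (div g j) j.1 := by rw [comp_iff, d_div]
  have c3 : Comp (mul (div g j) j.1 c2) (inv k.1) := by rw [div_mul]; exact comp_div g k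
  exact (mul_assoc' (div g j) j.1 (inv k.1) c2 c3 (comp_div j k) c).symm.trans
    (mul_congr (div_mul g j c2) rfl _ _)

lemma div_self (g : Fib u) : div g g = (r g.1 : G) := rfl

/-- Every `h` with `r(h) = r(g)` is of the form `g j⁻¹` with `j = h⁻¹ g`. -/
def divEquiv (g : Fib u) : Fib u ≃ {h : G // r h = r g.1} where
  toFun j := ⟨div g j, r_div g j⟩
  invFun h := ⟨mul (inv h.1) g.1 (by rw [comp_iff, d_inv, h.2]), by rw [d_mul, g.2]⟩
  left_inv j := by
    apply Subtype.ext
    have e : inv (div g j) = div j g := inv_div g j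
    exact (mul_congr e rfl _ (by rw [comp_iff, d_div])).trans (div_mul j g _)
  right_inv h := by
    apply Subtype.ext
    have c : Comp (inv h.1) g.1 := by rw [comp_iff, d_inv, h.2]
    have c1 : Comp (inv g.1) h.1 := by rw [comp_iff, d_inv, h.2]
    change mul g.1 (inv (mul (inv h.1) g.1 c)) _ = h.1
    have e : inv (mul (inv h.1) g.1 c) = mul (inv g.1) h.1 c1 := by
      rw [inv_mul_rev _ _ _ (by rw [inv_inv]; exact c1)]
      exact mul_congr rfl (inv_inv _) _ _
    have c2 : Comp g.1 (mul (inv g.1) h.1 c1) := by rw [comp_iff, r_mul, r_inv]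
    exact (mul_congr rfl e _ c2).trans (mul_inv_mul_left _ _ _ _)

end Algebra

end GroupoidSet

/-! ### Operators on `ℓ²(I)` given by matrices with uniformly finite rows and columns -/

/-- The entries of the matrix `a` are bounded by `M`, and each row and each column has at most `N`
non-zero entries. -/
structure SchurBound {I : Type u} (a : I → I → ℂ) (M : ℝ) (N : ℕ) : Prop where
  nonneg : 0 ≤ M
  le : ∀ i j, ‖a i j‖ ≤ M
  row : ∀ i, {j | a i j ≠ 0}.encard ≤ N
  col : ∀ j, {i | a i j ≠ 0}.encard ≤ N

namespace SchurBound

variable {I : Type u} {a b : I → I → ℂ} {M M' : ℝ} {N N' : ℕ}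

lemma finite_row (h : SchurBound a M N) (i : I) : {j | a i j ≠ 0}.Finite :=
  Set.finite_of_encard_le_coe (h.row i)

lemma summable_row (h : SchurBound a M N) (i : I) (ξ : I → ℂ) :
    Summable fun j => a i j * ξ j :=
  summable_of_hasFiniteSupport ((h.finite_row i).subset fun j hj => by
    simp only [Function.mem_support] at hj; exact left_ne_zero_of_mul hj)

lemma tsum_row (h : SchurBound a M N) (i : I) (ξ : I → ℂ) :
    ∑' j, a i j * ξ j = ∑ j ∈ (h.finite_row i).toFinset, a i j * ξ j :=
  tsum_eq_sum fun j hj => by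
    simp only [Set.Finite.mem_toFinset, Set.mem_ofPred_eq, not_not] at hj
    rw [hj, zero_mul]

lemma sum_le (h : SchurBound a M N) (ξ : ℓ²(I, ℂ)) (s : Finset I) :
    ∑ i ∈ s, ‖∑' j, a i j * ξ j‖ ^ 2 ≤ (N * M * ‖ξ‖) ^ 2 := by
  classical
  set R : I → Finset I := fun i => (h.finite_row i).toFinset with hR
  have hcard : ∀ i, ((R i).card : ℝ) ≤ N := fun i => by
    have := h.row i
    rw [(h.finite_row i).encard_eq_coe_toFinset_card] at this
    exact_mod_cast this
  have h1 : ∀ i, ‖∑' j, a i j * ξ j‖ ^ 2 ≤ N * M ^ 2 * ∑ j ∈ R i, ‖ξ j‖ ^ 2 := fun i => by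
    rw [h.tsum_row i]
    calc ‖∑ j ∈ R i, a i j * ξ j‖ ^ 2 ≤ (∑ j ∈ R i, M * ‖ξ j‖) ^ 2 := by
          gcongr
          refine (norm_sum_le _ _).trans (Finset.sum_le_sum fun j _ => ?_)
          rw [norm_mul]; exact mul_le_mul_of_nonneg_right (h.le i j) (norm_nonneg _)
      _ ≤ (R i).card * ∑ j ∈ R i, (M * ‖ξ j‖) ^ 2 := sq_sum_le_card_mul_sum_sq
      _ = (R i).card * (M ^ 2 * ∑ j ∈ R i, ‖ξ j‖ ^ 2) := by
          simp only [mul_pow, Finset.mul_sum]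
      _ ≤ N * (M ^ 2 * ∑ j ∈ R i, ‖ξ j‖ ^ 2) :=
          mul_le_mul_of_nonneg_right (hcard i) (by positivity)
      _ = _ := by ring
  set T := s.biUnion R
  have h2 : ∑ i ∈ s, ∑ j ∈ R i, ‖ξ j‖ ^ 2 ≤ N * ∑ j ∈ T, ‖ξ j‖ ^ 2 := by
    calc ∑ i ∈ s, ∑ j ∈ R i, ‖ξ j‖ ^ 2
        = ∑ i ∈ s, ∑ j ∈ T, if j ∈ R i then ‖ξ j‖ ^ 2 else 0 := by
          refine Finset.sum_congr rfl fun i hi => ?_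
          rw [← Finset.sum_filter]
          congr 1
          ext j
          simp only [Finset.mem_filter, T, Finset.mem_biUnion]
          exact ⟨fun hj => ⟨⟨i, hi, hj⟩, hj⟩, fun hj => hj.2⟩
      _ = ∑ j ∈ T, ∑ i ∈ s, if j ∈ R i then ‖ξ j‖ ^ 2 else 0 := Finset.sum_comm
      _ ≤ ∑ j ∈ T, N * ‖ξ j‖ ^ 2 := by
          refine Finset.sum_le_sum fun j _ => ?_
          rw [← Finset.sum_filter, Finset.sum_const, nsmul_eq_mul]
          refine mul_le_mul_of_nonneg_right ?_ (by positivity)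
          have := (Set.encard_le_encard (s := ((s.filter fun i => j ∈ R i : Finset I) : Set I))
            (t := {i | a i j ≠ 0}) (fun i hi => by
              simpa [hR] using (Finset.mem_filter.1 (Finset.mem_coe.1 hi)).2)).trans (h.col j)
          rw [Set.encard_coe_eq_coe_finsetCard] at this
          exact_mod_cast this
      _ = _ := by rw [Finset.mul_sum]
  have h3 : ∑ j ∈ T, ‖ξ j‖ ^ 2 ≤ ‖ξ‖ ^ 2 := by
    have := lp.sum_rpow_le_norm_rpow (p := 2) (by simp) ξ T
    simpa using this
  calc ∑ i ∈ s, ‖∑' j, a i j * ξ j‖ ^ 2 ≤ ∑ i ∈ s, N * M ^ 2 * ∑ j ∈ R i, ‖ξ j‖ ^ 2 :=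
        Finset.sum_le_sum fun i _ => h1 i
    _ = N * M ^ 2 * ∑ i ∈ s, ∑ j ∈ R i, ‖ξ j‖ ^ 2 := by rw [Finset.mul_sum]
    _ ≤ N * M ^ 2 * (N * ‖ξ‖ ^ 2) := by
        refine mul_le_mul_of_nonneg_left (h2.trans ?_) (by positivity)
        gcongr
    _ = _ := by ring

lemma memℓp (h : SchurBound a M N) (ξ : ℓ²(I, ℂ)) : Memℓp (fun i => ∑' j, a i j * ξ j) 2 :=
  memℓp_gen' (C := (N * M * ‖ξ‖) ^ 2) fun s => by simpa using h.sum_le ξ s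

/-- The operator on `ℓ²(I)` with matrix `a`, that is `(A ξ)(i) = ∑ⱼ a i j ξ(j)`. -/
noncomputable def op (h : SchurBound a M N) : ℓ²(I, ℂ) →L[ℂ] ℓ²(I, ℂ) :=
  LinearMap.mkContinuous
    { toFun := fun ξ => ⟨fun i => ∑' j, a i j * ξ j, h.memℓp ξ⟩
      map_add' := fun ξ η => by
        ext i
        simp only [lp.coeFn_add, Pi.add_apply, mul_add]
        exact (h.summable_row i ξ).tsum_add (h.summable_row i η)
      map_smul' := fun c ξ => by
        ext i
        simp only [lp.coeFn_smul, Pi.smul_apply, smul_eq_mul, RingHom.id_apply]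
        rw [← tsum_mul_left]
        exact tsum_congr fun j => by ring }
    (N * M) fun ξ => by
      have hM := h.nonneg
      refine lp.norm_le_of_forall_sum_le (by simp) (by positivity) fun s => ?_
      simpa using h.sum_le ξ s

lemma op_apply (h : SchurBound a M N) (ξ : ℓ²(I, ℂ)) (i : I) :
    h.op ξ i = ∑' j, a i j * ξ j := rfl

lemma norm_op_le (h : SchurBound a M N) : ‖h.op‖ ≤ N * M :=
  LinearMap.mkContinuous_norm_le _ (mul_nonneg (Nat.cast_nonneg _) h.nonneg) _

lemma adjoint_op (h : SchurBound a M N) (h' : SchurBound b M' N')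
    (e : ∀ i j, b i j = star (a j i)) : star h.op = h'.op := by
  classical
  ext ξ i
  rw [op_apply, ContinuousLinearMap.star_eq_adjoint]
  have h1 := lp.inner_single_left (𝕜 := ℂ) i (1 : ℂ) (ContinuousLinearMap.adjoint h.op ξ)
  rw [ContinuousLinearMap.adjoint_inner_right, lp.inner_eq_tsum] at h1
  simp only [RCLike.inner_apply, map_one, mul_one] at h1
  rw [← h1]
  refine tsum_congr fun j => ?_
  have : h.op (lp.single 2 i (1 : ℂ)) j = a j i := by
    rw [op_apply, tsum_eq_single i]
    · rw [lp.single_apply_self, mul_one]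
    · intro k hk
      rw [lp.single_apply_ne _ _ _ hk, mul_zero]
  rw [this, e, mul_comm]; rfl

lemma mul_op {c : I → I → ℂ} {M'' : ℝ} {N'' : ℕ} (h : SchurBound a M N) (h' : SchurBound b M' N')
    (h'' : SchurBound c M'' N'') (e : ∀ i k, c i k = ∑' j, a i j * b j k) :
    h.op * h'.op = h''.op := by
  ext ξ i
  rw [mul_apply_eq_comp, op_apply, op_apply, h.tsum_row i]
  simp only [op_apply, e]
  simp_rw [h.tsum_row i, Finset.sum_mul, mul_assoc]
  rw [Summable.tsum_finsetSum]
  · exact Finset.sum_congr rfl fun j _ => by rw [tsum_mul_left]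
  · exact fun j _ => (h'.summable_row j ξ).mul_left _

end SchurBound

/-! ### Étale groupoids -/

namespace GroupoidSet

section Topology

variable {G : Type u} [TopologicalSpace G] [GroupoidSet G]

/-- Open bisections: open sets on which `r` and `d` are homeomorphisms onto open subsets. -/
structure IsOpenBisection (S : Set G) : Prop where
  isOpen : IsOpen S
  r_isOpenEmbedding : IsOpenEmbedding (S.domRestrict fun g => (r g : G))
  d_isOpenEmbedding : IsOpenEmbedding (S.domRestrict fun g => (d g : G))

end Topology

end GroupoidSet

open GroupoidSet

/-- Étale groupoids: the operations are continuous, and the open bisections form a basis of the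
topology. -/
class EtaleGroupoid (G : Type u) [TopologicalSpace G] extends GroupoidSet G where
  continuous_mul : Continuous fun p : {p : G × G // Comp p.1 p.2} => mul p.1.1 p.1.2 p.2
  continuous_inv : Continuous (inv : G → G)
  isTopologicalBasis : TopologicalSpace.IsTopologicalBasis {S : Set G | IsOpenBisection S}

namespace EtaleGroupoid

lemma exists_card_bound {H B : Type u} [TopologicalSpace H] [TopologicalSpace B] {p : H → B}
    (hp : IsLocalHomeomorph p) {K : Set H} (hK : IsCompact K) :
    ∃ N : ℕ, ∀ b, {h | h ∈ K ∧ p h = b}.encard ≤ N := by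
  refine hK.induction_on (p := fun K => ∃ N : ℕ, ∀ b, {h | h ∈ K ∧ p h = b}.encard ≤ N)
    ?_ ?_ ?_ ?_
  · exact ⟨0, by simp⟩
  · rintro s t hst ⟨N, hN⟩
    refine ⟨N, fun b => (Set.encard_le_encard ?_).trans (hN b)⟩
    exact fun h hh => ⟨hst hh.1, hh.2⟩
  · rintro s t ⟨N, hN⟩ ⟨N', hN'⟩
    refine ⟨N + N', fun b => ?_⟩
    have : {h | h ∈ s ∪ t ∧ p h = b} = {h | h ∈ s ∧ p h = b} ∪ {h | h ∈ t ∧ p h = b} := by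
      ext h; simp only [Set.mem_union, Set.mem_ofPred_eq]; tauto
    rw [this]
    refine (Set.encard_union_le _ _).trans ?_
    push_cast
    exact add_le_add (hN b) (hN' b)
  · intro x _
    obtain ⟨e, hx, rfl⟩ := hp x
    refine ⟨e.source, mem_nhdsWithin_of_mem_nhds (e.open_source.mem_nhds hx), 1, fun b => ?_⟩
    rw [Nat.cast_one, Set.encard_le_one_iff]
    exact fun h h' hh hh' => e.injOn hh.1 hh'.1 (hh.2.trans hh'.2.symm)

/-- Sums over the fibres of a local homeomorphism are continuous. -/
lemma continuous_fiber_sum {H B X : Type u} [TopologicalSpace H] [TopologicalSpace B]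
    [TopologicalSpace X] [T2Space H] [T2Space B] {p : H → B} (hp : IsLocalHomeomorph p)
    {q : X → B} (hq : Continuous q) {F : H → X → ℂ}
    (hF : ContinuousOn (Function.uncurry F) {z | p z.1 = q z.2})
    {K : Set H} (hK : IsCompact K) (hFK : ∀ h x, F h x ≠ 0 → h ∈ K)
    (hFp : ∀ h x, F h x ≠ 0 → p h = q x) :
    Continuous fun x => ∑' h, F h x := by
  classical
  rw [continuous_iff_continuousAt]
  intro x₀
  set b₀ := q x₀
  have hfin : {h | h ∈ K ∧ p h = b₀}.Finite := by
    obtain ⟨N, hN⟩ := exists_card_bound hp hK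
    exact Set.finite_of_encard_le_coe (hN b₀)
  choose e he hpe using hp
  obtain ⟨V, hV, hVd⟩ := hfin.t2_separation
  set W : H → Set H := fun h => V h ∩ (e h).source with hW
  have hWo : ∀ h, IsOpen (W h) := fun h => (hV h).2.inter (e h).open_source
  have hWm : ∀ h, h ∈ W h := fun h => ⟨(hV h).1, he h⟩
  set A := hfin.toFinset
  have hA : ∀ {h}, h ∈ A ↔ h ∈ K ∧ p h = b₀ := fun {h} => by simp [A]
  have hKc : IsCompact (K \ ⋃ h ∈ A, W h) :=
    hK.diff (isOpen_biUnion fun h _ => hWo h)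
  have hpc : Continuous p := by
    rw [continuous_iff_continuousAt]
    intro h
    have := (e h).continuousAt (he h)
    rwa [← hpe h] at this
  have h1 : ∀ᶠ x in 𝓝 x₀, q x ∉ p '' (K \ ⋃ h ∈ A, W h) := by
    have hcl : IsClosed (p '' (K \ ⋃ h ∈ A, W h)) := (hKc.image hpc).isClosed
    refine hq.continuousAt.eventually (hcl.isOpen_compl.mem_nhds ?_)
    rintro ⟨h, ⟨hhK, hh⟩, hhb⟩
    exact hh (Set.mem_biUnion (hA.2 ⟨hhK, hhb⟩) (hWm h))
  have hsec : ∀ h ∈ A, b₀ ∈ (e h).target ∧ (e h).symm b₀ = h := fun h hh => by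
    have e1 : e h h = b₀ := by rw [← hpe h]; exact (hA.1 hh).2
    exact ⟨e1 ▸ (e h).map_source (he h), by rw [← e1]; exact (e h).left_inv (he h)⟩
  have h2 : ∀ᶠ x in 𝓝 x₀, ∀ h ∈ A, q x ∈ (e h).target ∧ (e h).symm (q x) ∈ W h := by
    rw [Filter.eventually_all_finset]
    intro h hh
    obtain ⟨ht, hs⟩ := hsec h hh
    have hc : ContinuousAt (fun x => (e h).symm (q x)) x₀ :=
      ((e h).continuousAt_symm ht).comp (f := q) hq.continuousAt
    refine (hq.continuousAt.eventually ((e h).open_target.mem_nhds ht)).and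
      (hc.eventually ((hWo h).mem_nhds ?_))
    change (e h).symm b₀ ∈ W h
    rw [hs]; exact hWm h
  have h3 : ∀ᶠ x in 𝓝 x₀, ∑ h ∈ A, F ((e h).symm (q x)) x = ∑' h, F h x := by
    filter_upwards [h1, h2] with x hx1 hx2
    have hinj : Set.InjOn (fun h => (e h).symm (q x)) A := by
      intro h hh h' hh' heq
      by_contra hne
      have hd := hVd (hA.1 hh) (hA.1 hh') hne
      refine Set.disjoint_left.1 hd (hx2 h hh).2.1 ?_
      have := (hx2 h' hh').2.1
      change (e h).symm (q x) = (e h').symm (q x) at heq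
      rwa [← heq] at this
    rw [tsum_eq_sum (s := A.image fun h => (e h).symm (q x)), Finset.sum_image hinj]
    intro k hk
    by_contra hne
    have hkK := hFK _ _ hne
    have hkp := hFp _ _ hne
    have : k ∈ ⋃ h ∈ A, W h := by
      by_contra hk'
      exact hx1 ⟨k, ⟨hkK, hk'⟩, hkp⟩
    obtain ⟨h, hh, hkW⟩ := Set.mem_iUnion₂.1 this
    refine hk (Finset.mem_image.2 ⟨h, hh, ?_⟩)
    rw [← hkp, hpe h]
    exact (e h).left_inv hkW.2
  refine ContinuousAt.congr ?_ h3
  refine tendsto_finsetSum A fun h hh => ?_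
  obtain ⟨ht, hs⟩ := hsec h hh
  have hc : ContinuousAt (fun x => (e h).symm (q x)) x₀ :=
    ((e h).continuousAt_symm ht).comp (f := q) hq.continuousAt
  have hz : ((e h).symm (q x₀), x₀) ∈ {z : H × X | p z.1 = q z.2} := by
    change p ((e h).symm (q x₀)) = q x₀
    change p ((e h).symm b₀) = b₀
    rw [hs]; exact (hA.1 hh).2
  have hFc := hF _ hz
  refine hFc.tendsto.comp (tendsto_nhdsWithin_iff.2 ⟨hc.prodMk continuousAt_id, ?_⟩)
  filter_upwards [h2] with x hx
  change p ((e h).symm (q x)) = q x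
  have := (e h).right_inv (hx h hh).1
  conv_lhs => rw [hpe h]
  exact this

variable {G : Type u} [TopologicalSpace G] [EtaleGroupoid G]

lemma exists_bisection (g : G) : ∃ S : Set G, IsOpenBisection S ∧ g ∈ S := by
  obtain ⟨S, hS, hg, -⟩ := (isTopologicalBasis (G := G)).exists_subset_of_mem_open
    (Set.mem_univ g) isOpen_univ
  exact ⟨S, hS, hg⟩

lemma isLocalHomeomorph_r : IsLocalHomeomorph fun g : G => (r g : G) := by
  rw [isLocalHomeomorph_iff_isOpenEmbedding_restrict]
  intro g
  obtain ⟨S, hS, hg⟩ := exists_bisection g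
  exact ⟨S, hS.isOpen.mem_nhds hg, hS.r_isOpenEmbedding⟩

lemma isLocalHomeomorph_d : IsLocalHomeomorph fun g : G => (d g : G) := by
  rw [isLocalHomeomorph_iff_isOpenEmbedding_restrict]
  intro g
  obtain ⟨S, hS, hg⟩ := exists_bisection g
  exact ⟨S, hS.isOpen.mem_nhds hg, hS.d_isOpenEmbedding⟩

lemma continuous_r_coe : Continuous fun g : G => (r g : G) := isLocalHomeomorph_r.continuous
lemma continuous_d_coe : Continuous fun g : G => (d g : G) := isLocalHomeomorph_d.continuous
lemma continuous_r : Continuous (r : G → UnitSpace G) := continuous_r_coe.subtype_mk _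
lemma continuous_d : Continuous (d : G → UnitSpace G) := continuous_d_coe.subtype_mk _

lemma isOpen_unitSet : IsOpen (unitSet G) := by
  have : unitSet G = Set.range fun g : G => (r g : G) := rfl
  rw [this]
  exact isLocalHomeomorph_r.isOpenMap.isOpen_range

lemma mem_unitSet_iff {g : G} : g ∈ unitSet G ↔ (r g : G) = g :=
  ⟨fun h => congrArg Subtype.val (r_coe_unit ⟨g, h⟩), fun h => h ▸ (r g).2⟩

lemma isClosed_unitSet [T2Space G] : IsClosed (unitSet G) := by
  have : unitSet G = {g : G | (r g : G) = g} := Set.ext fun g => mem_unitSet_iff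
  rw [this]
  exact isClosed_eq continuous_r_coe continuous_id

lemma isClosed_comp [T2Space G] : IsClosed {p : G × G | Comp p.1 p.2} := by
  have : {p : G × G | Comp p.1 p.2} = {p : G × G | (d p.1 : G) = r p.2} := by
    ext p; simp only [Set.mem_ofPred_eq, comp_iff, Subtype.ext_iff]
  rw [this]
  exact isClosed_eq (continuous_d_coe.comp continuous_fst) (continuous_r_coe.comp continuous_snd)

instance [T2Space G] [LocallyCompactSpace G] : LocallyCompactSpace (UnitSpace G) :=
  isClosed_unitSet.isClosedEmbedding_subtypeVal.locallyCompactSpace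

end EtaleGroupoid

/-! ### The convolution algebra, the regular representations and the reduced C*-algebra -/

namespace EtaleGroupoid

section RegularRepresentation

variable {G : Type u} [TopologicalSpace G] [EtaleGroupoid G]

/-- The matrix `(f(g k⁻¹))_{g, k ∈ G_u}`. -/
noncomputable def regMatrix (f : C_c(G, ℂ)) (u : UnitSpace G) : Fib u → Fib u → ℂ := fun g k => f (div g k)

lemma exists_schurBound (f : C_c(G, ℂ)) :
    ∃ (M : ℝ) (N : ℕ), ∀ u : UnitSpace G, SchurBound (regMatrix f u) M N := by
  obtain ⟨C, hC⟩ := f.hasCompactSupport.exists_bound_of_continuous f.continuous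
  obtain ⟨N, hN⟩ := exists_card_bound (isLocalHomeomorph_r (G := G)) f.hasCompactSupport
  obtain ⟨N', hN'⟩ := exists_card_bound (isLocalHomeomorph_d (G := G)) f.hasCompactSupport
  refine ⟨max C 0, max N N', fun u => ⟨le_max_right _ _, fun i j => (hC _).trans (le_max_left _ _),
    fun i => ?_, fun j => ?_⟩⟩
  · refine le_trans ?_ ((hN (r i.1)).trans (by exact_mod_cast le_max_left N N'))
    refine Set.encard_le_encard_of_injOn (f := fun j => div i j) ?_
      fun j _ j' _ e => div_right_inj e
    exact fun j hj => ⟨subset_tsupport _ hj, congrArg Subtype.val (r_div i j)⟩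
  · refine le_trans ?_ ((hN' (r j.1)).trans (by exact_mod_cast le_max_right N N'))
    refine Set.encard_le_encard_of_injOn (f := fun i => div i j) ?_
      fun i _ i' _ e => div_left_inj e
    exact fun i hi => ⟨subset_tsupport _ hi, congrArg Subtype.val (d_div i j)⟩

/-- The regular representation `π_u(f)` on `ℓ²(G_u)`. -/
noncomputable def regRepAt (f : C_c(G, ℂ)) (u : UnitSpace G) :
    ℓ²(Fib u, ℂ) →L[ℂ] ℓ²(Fib u, ℂ) :=
  ((exists_schurBound f).choose_spec.choose_spec u).op

lemma regRepAt_apply (f : C_c(G, ℂ)) (u : UnitSpace G) (ξ : ℓ²(Fib u, ℂ)) (g : Fib u) :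
    regRepAt f u ξ g = ∑' k : Fib u, f (div g k) * ξ k := rfl

/-- `π_u(f) ξ` is the convolution product `(f * ξ)(g) = ∑_{r(h) = r(g)} f(h) ξ(h⁻¹ g)`. -/
lemma regRepAt_eq_convolution (f : C_c(G, ℂ)) (u : UnitSpace G) (ξ : ℓ²(Fib u, ℂ)) (g : Fib u) :
    regRepAt f u ξ g = ∑' h : {h : G // r h = r g.1}, f h.1 *
      ξ ⟨mul (inv h.1) g.1 (by rw [comp_iff, d_inv, h.2]), by rw [d_mul, g.2]⟩ := by
  rw [regRepAt_apply, ← (divEquiv g).tsum_eq]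
  refine tsum_congr fun k => ?_
  have := (divEquiv g).symm_apply_apply k
  exact congrArg (fun j => f (div g k) * ξ j) this.symm

variable (G) in
/-- The C*-algebra `∏_u B(ℓ²(G_u))` of bounded families, with the supremum norm. -/
def OpAlg : Type u :=
  lp (fun v : UnitSpace G => ℓ²(Fib v, ℂ) →L[ℂ] ℓ²(Fib v, ℂ)) ∞

noncomputable instance : NonUnitalCStarAlgebra (OpAlg G) :=
  inferInstanceAs (NonUnitalCStarAlgebra
    (lp (fun v : UnitSpace G => ℓ²(Fib v, ℂ) →L[ℂ] ℓ²(Fib v, ℂ)) ∞))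

/-- The component at `v`. -/
def OpAlg.proj (x : OpAlg G) (v : UnitSpace G) : ℓ²(Fib v, ℂ) →L[ℂ] ℓ²(Fib v, ℂ) := x.1 v

@[ext]
lemma OpAlg.ext {x y : OpAlg G} (h : ∀ v, x.proj v = y.proj v) : x = y :=
  Subtype.ext (funext h)

lemma OpAlg.proj_zero (v : UnitSpace G) : (0 : OpAlg G).proj v = 0 := rfl
lemma OpAlg.proj_add (x y : OpAlg G) (v : UnitSpace G) : (x + y).proj v = x.proj v + y.proj v := rfl
lemma OpAlg.proj_mul (x y : OpAlg G) (v : UnitSpace G) : (x * y).proj v = x.proj v * y.proj v := rfl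
lemma OpAlg.proj_smul (c : ℂ) (x : OpAlg G) (v : UnitSpace G) :
    (c • x).proj v = c • x.proj v := rfl
lemma OpAlg.proj_star (x : OpAlg G) (v : UnitSpace G) : (star x).proj v = star (x.proj v) := rfl

lemma OpAlg.norm_proj_le (x : OpAlg G) (v : UnitSpace G) : ‖x.proj v‖ ≤ ‖x‖ :=
  lp.norm_apply_le_norm (by simp) (x : lp (fun v : UnitSpace G => ℓ²(Fib v, ℂ) →L[ℂ] ℓ²(Fib v, ℂ)) ∞) v

/-- A bounded family of operators as an element of the product. -/
def OpAlg.mk (T : ∀ v : UnitSpace G, ℓ²(Fib v, ℂ) →L[ℂ] ℓ²(Fib v, ℂ)) (C : ℝ)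
    (h : ∀ v, ‖T v‖ ≤ C) : OpAlg G :=
  ⟨T, memℓp_infty ⟨C, by rintro _ ⟨v, rfl⟩; exact h v⟩⟩

lemma OpAlg.proj_mk (T : ∀ v : UnitSpace G, ℓ²(Fib v, ℂ) →L[ℂ] ℓ²(Fib v, ℂ)) (C : ℝ)
    (h : ∀ v, ‖T v‖ ≤ C) (v : UnitSpace G) : (OpAlg.mk T C h).proj v = T v := rfl

/-- The family `(π_u(f))_u`. -/
noncomputable def regRep : C_c(G, ℂ) →ₗ[ℂ] OpAlg G where
  toFun f := OpAlg.mk (fun v => regRepAt f v)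
    ((exists_schurBound f).choose_spec.choose * (exists_schurBound f).choose)
    fun v => ((exists_schurBound f).choose_spec.choose_spec v).norm_op_le
  map_add' f f' := by
    obtain ⟨M, N, h⟩ := exists_schurBound f
    obtain ⟨M', N', h'⟩ := exists_schurBound f'
    refine OpAlg.ext fun v => ?_
    ext ξ g
    change regRepAt (f + f') v ξ g = regRepAt f v ξ g + regRepAt f' v ξ g
    simp only [regRepAt_apply, CompactlySupportedContinuousMap.add_apply, add_mul]
    exact ((h v).summable_row g ξ).tsum_add ((h' v).summable_row g ξ)
  map_smul' c f := by
    refine OpAlg.ext fun v => ?_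
    ext ξ g
    change regRepAt (c • f) v ξ g = c * regRepAt f v ξ g
    simp only [regRepAt_apply, CompactlySupportedContinuousMap.smul_apply, smul_eq_mul, mul_assoc]
    rw [tsum_mul_left]

lemma regRep_proj (f : C_c(G, ℂ)) (v : UnitSpace G) : (regRep f).proj v = regRepAt f v := rfl

/-- The involution `f*(g) = conj f(g⁻¹)`. -/
noncomputable def involution (f : C_c(G, ℂ)) : C_c(G, ℂ) where
  toFun g := star (f (inv g))
  continuous_toFun := continuous_star.comp (f.continuous.comp EtaleGroupoid.continuous_inv)
  hasCompactSupport' := by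
    let e : G ≃ₜ G := ⟨⟨inv, inv, GroupoidSet.inv_inv, GroupoidSet.inv_inv⟩,
      EtaleGroupoid.continuous_inv, EtaleGroupoid.continuous_inv⟩
    exact (f.hasCompactSupport.comp_homeomorph e).comp_left (star_zero ℂ)

lemma star_regRep (f : C_c(G, ℂ)) : star (regRep f) = regRep (involution f) := by
  obtain ⟨M, N, h⟩ := exists_schurBound f
  obtain ⟨M', N', h'⟩ := exists_schurBound (involution f)
  refine OpAlg.ext fun v => ?_
  change star (h v).op = (h' v).op
  refine (h v).adjoint_op (h' v) fun i j => ?_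
  change star (f (inv (div i j))) = star (f (div j i))
  rw [GroupoidSet.inv_div]

variable [T2Space G]

/-- The convolution `(f₁ * f₂)(g) = ∑_{r(h) = r(g)} f₁(h) f₂(h⁻¹ g)`. -/
noncomputable def convolution (f₁ f₂ : C_c(G, ℂ)) : C_c(G, ℂ) where
  toFun g := ∑' h : {h : G // r h = r g},
    f₁ h.1 * f₂ (mul (inv h.1) g (by rw [comp_iff, d_inv, h.2]))
  continuous_toFun := by
    classical
    let F : G → G → ℂ := fun h g => if c : r h = r g then
      f₁ h * f₂ (mul (inv h) g (by rw [comp_iff, d_inv, c])) else 0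
    have hF : (fun g => ∑' h : {h : G // r h = r g},
        f₁ h.1 * f₂ (mul (inv h.1) g (by rw [comp_iff, d_inv, h.2]))) =
        fun g => ∑' h, F h g := by
      funext g
      rw [← tsum_subtype_eq_of_support_subset (f := fun h => F h g) (s := {h | r h = r g})]
      · refine tsum_congr fun h => ?_
        have : r h.1 = r g := h.2
        simp only [F, dif_pos this]
      · intro h hh
        by_contra hc
        exact hh (dif_neg hc)
    rw [hF]
    refine continuous_fiber_sum isLocalHomeomorph_r continuous_r_coe ?_ f₁.hasCompactSupport ?_ ?_
    · rw [continuousOn_iff_continuous_domRestrict]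
      have hcomp : ∀ z : {z : G × G | (r z.1 : G) = r z.2}, Comp (inv z.1.1) z.1.2 := fun z => by
        rw [comp_iff, d_inv]; exact Subtype.ext z.2
      have hm : Continuous fun z : {z : G × G | (r z.1 : G) = r z.2} =>
          mul (inv z.1.1) z.1.2 (hcomp z) :=
        EtaleGroupoid.continuous_mul.comp (f := fun z : {z : G × G | (r z.1 : G) = r z.2} =>
          (⟨(inv z.1.1, z.1.2), hcomp z⟩ :
            {p : G × G // Comp p.1 p.2}))
          (Continuous.subtype_mk (f := fun z : {z : G × G | (r z.1 : G) = r z.2} =>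
            (inv z.1.1, z.1.2))
          ((EtaleGroupoid.continuous_inv.comp (continuous_fst.comp continuous_subtype_val)).prodMk
            (continuous_snd.comp continuous_subtype_val)) hcomp)
      refine ((f₁.continuous.comp (continuous_fst.comp continuous_subtype_val)).mul
        (f₂.continuous.comp hm)).congr fun z => ?_
      have : r z.1.1 = r z.1.2 := Subtype.ext z.2
      simp only [Set.domRestrict_apply, Function.uncurry, F, dif_pos this]
      rfl
    · intro h g hne
      simp only [F] at hne
      split_ifs at hne
      · exact subset_tsupport _ (left_ne_zero_of_mul hne)
      · exact absurd rfl hne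
    · intro h g hne
      by_contra hc
      exact hne (dif_neg fun e => hc (congrArg Subtype.val e))
  hasCompactSupport' := by
    have hK : IsCompact ((fun p : {p : G × G // Comp p.1 p.2} => mul p.1.1 p.1.2 p.2) ''
        (Subtype.val ⁻¹' (tsupport f₁ ×ˢ tsupport f₂))) :=
      ((isClosed_comp (G := G)).isClosedEmbedding_subtypeVal.isCompact_preimage
        (f₁.hasCompactSupport.isCompact.prod f₂.hasCompactSupport.isCompact)).image
        EtaleGroupoid.continuous_mul
    refine HasCompactSupport.intro hK fun g hg => ?_
    refine (tsum_congr fun h => ?_).trans tsum_zero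
    by_contra hne
    refine hg ⟨⟨(h.1, mul (inv h.1) g (by rw [comp_iff, d_inv, h.2])),
      by rw [comp_iff, r_mul, r_inv]⟩, ⟨?_, ?_⟩, ?_⟩
    · exact subset_tsupport _ (left_ne_zero_of_mul hne)
    · exact subset_tsupport _ (right_ne_zero_of_mul hne)
    · exact mul_inv_mul_left _ _ _ _

lemma regRep_mul (f₁ f₂ : C_c(G, ℂ)) :
    regRep f₁ * regRep f₂ = regRep (convolution f₁ f₂) := by
  obtain ⟨M₁, N₁, h₁⟩ := exists_schurBound f₁
  obtain ⟨M₂, N₂, h₂⟩ := exists_schurBound f₂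
  obtain ⟨M, N, h⟩ := exists_schurBound (convolution f₁ f₂)
  refine OpAlg.ext fun v => ?_
  change (h₁ v).op * (h₂ v).op = (h v).op
  refine (h₁ v).mul_op (h₂ v) (h v) fun i k => ?_
  change ∑' x : {x : G // r x = r (div i k)}, f₁ x.1 *
      f₂ (mul (inv x.1) (div i k) (by rw [comp_iff, d_inv, x.2])) =
    ∑' j, f₁ (div i j) * f₂ (div j k)
  let e : Fib v ≃ {x : G // r x = r (div i k)} :=
    (divEquiv i).trans (Equiv.subtypeEquivRight fun x => by rw [r_div])
  rw [← e.tsum_eq]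
  refine tsum_congr fun j => ?_
  change f₁ (div i j) * f₂ (mul (inv (div i j)) (div i k) _) = _
  congr 2
  exact (mul_congr (GroupoidSet.inv_div i j) rfl _ (by rw [comp_iff, d_div, r_div])).trans (div_mul_div j i k _)

variable (G) in
/-- The image of the *-algebra `C_c(G)` under the direct sum of the regular representations. -/
noncomputable def regRange : NonUnitalStarSubalgebra ℂ (OpAlg G) where
  carrier := Set.range (regRep (G := G))
  add_mem' := by
    rintro _ _ ⟨f, rfl⟩ ⟨f', rfl⟩
    exact ⟨f + f', map_add _ _ _⟩
  zero_mem' := ⟨0, map_zero _⟩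
  mul_mem' := by
    rintro _ _ ⟨f, rfl⟩ ⟨f', rfl⟩
    exact ⟨convolution f f', (regRep_mul f f').symm⟩
  smul_mem' := by
    rintro c _ ⟨f, rfl⟩
    exact ⟨c • f, map_smul _ _ _⟩
  star_mem' := by
    rintro _ ⟨f, rfl⟩
    exact ⟨involution f, (star_regRep f).symm⟩

variable (G) in
/-- The reduced C*-algebra as a C*-subalgebra of `∏_u B(ℓ²(G_u))`: the completion of `C_c(G)` in
the norm `‖f‖_r = sup_u ‖π_u(f)‖`. -/
noncomputable def reducedSubalgebra : NonUnitalStarSubalgebra ℂ (OpAlg G) :=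
  (regRange G).topologicalClosure

variable (G) in
/-- The reduced C*-algebra `C_r^*(G)`. -/
abbrev ReducedCStar : Type u := ↥(reducedSubalgebra G)

/-- The canonical map `C_c(G) → C_r^*(G)`. -/
noncomputable def ofCc (f : C_c(G, ℂ)) : ReducedCStar G :=
  ⟨regRep f, (regRange G).le_topologicalClosure ⟨f, rfl⟩⟩

end RegularRepresentation

end EtaleGroupoid

/-! ### Closed ideals and the Fell topology -/

/-- Closed two-sided ideals of a complex topological algebra, not necessarily unital (so that
closedness under scalar multiplication has to be required). -/
structure ClosedIdeal (A : Type u) [NonUnitalRing A] [Module ℂ A] [TopologicalSpace A] extends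
    Submodule ℂ A where
  mul_mem_left' : ∀ (a : A) {x : A}, x ∈ carrier → a * x ∈ carrier
  mul_mem_right' : ∀ (a : A) {x : A}, x ∈ carrier → x * a ∈ carrier
  isClosed' : IsClosed carrier

namespace ClosedIdeal

variable {A : Type u} [NonUnitalRing A] [Module ℂ A] [TopologicalSpace A]

instance : SetLike (ClosedIdeal A) A where
  coe I := I.carrier
  coe_injective := by
    rintro ⟨I, _, _, _⟩ ⟨J, _, _, _⟩ h
    have : I = J := SetLike.coe_injective h
    subst this
    rfl

instance : PartialOrder (ClosedIdeal A) := .ofSetLike (ClosedIdeal A) A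

lemma mul_mem_left (I : ClosedIdeal A) (a : A) {x : A} (hx : x ∈ I) : a * x ∈ I :=
  I.mul_mem_left' a hx

lemma mul_mem_right (I : ClosedIdeal A) (a : A) {x : A} (hx : x ∈ I) : x * a ∈ I :=
  I.mul_mem_right' a hx

instance : InfSet (ClosedIdeal A) where
  sInf S :=
    { carrier := {x | ∀ I ∈ S, x ∈ I}
      add_mem' := fun hx hy I hI => I.toSubmodule.add_mem (hx I hI) (hy I hI)
      zero_mem' := fun _ _ => Submodule.zero_mem _
      smul_mem' := fun c _ hx I hI => I.toSubmodule.smul_mem c (hx I hI)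
      mul_mem_left' := fun a _ hx I hI => I.mul_mem_left a (hx I hI)
      mul_mem_right' := fun a _ hx I hI => I.mul_mem_right a (hx I hI)
      isClosed' := by
        have : {x : A | ∀ I ∈ S, x ∈ I} = ⋂ I ∈ S, (I : Set A) := by ext; simp
        rw [this]
        exact isClosed_biInter fun I _ => I.isClosed' }

/-- The lattice of closed ideals: the infimum is the intersection, the supremum of `I` and `J` is
the smallest closed ideal that contains both (in a C*-algebra this is `I + J`). -/
instance : CompleteLattice (ClosedIdeal A) :=
  completeLatticeOfInf (ClosedIdeal A) fun _ =>
    ⟨fun _ hI _ hx => hx _ hI, fun _ hJ _ hx _ hI => hJ hI hx⟩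

lemma mem_inf {I J : ClosedIdeal A} {x : A} : x ∈ I ⊓ J ↔ x ∈ I ∧ x ∈ J := by
  constructor
  · exact fun h => ⟨(inf_le_left : I ⊓ J ≤ I) h, (inf_le_right : I ⊓ J ≤ J) h⟩
  · rintro ⟨hI, hJ⟩ K (rfl | rfl)
    exacts [hI, hJ]

/-- The Fell topology: a subbase is given by the sets `{J | ¬ I ⊆ J}`. -/
instance fellTopology : TopologicalSpace (ClosedIdeal A) :=
  TopologicalSpace.generateFrom {s | ∃ I : ClosedIdeal A, s = {J | ¬ I ≤ J}}

/-- The ideal `C₀(U)` of `C₀(X)` for an open subset `U` of `X`. -/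
def ofOpens {X : Type u} [TopologicalSpace X] (U : TopologicalSpace.Opens X) :
    ClosedIdeal C₀(X, ℂ) where
  carrier := {f | ∀ x, x ∉ U → f x = 0}
  add_mem' := fun {f f'} hf hf' x hx => by
    rw [ZeroAtInftyContinuousMap.add_apply, hf x hx, hf' x hx, add_zero]
  zero_mem' := fun _ _ => rfl
  smul_mem' := fun c f hf x hx => by
    rw [ZeroAtInftyContinuousMap.smul_apply, hf x hx, smul_zero]
  mul_mem_left' := fun a f hf x hx => by
    rw [ZeroAtInftyContinuousMap.mul_apply, hf x hx, mul_zero]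
  mul_mem_right' := fun a f hf x hx => by
    rw [ZeroAtInftyContinuousMap.mul_apply, hf x hx, zero_mul]
  isClosed' := by
    have : {f : C₀(X, ℂ) | ∀ x, x ∉ U → f x = 0} = ⋂ (x : X) (_ : x ∉ U), {f | f x = 0} := by
      ext; simp
    rw [this]
    refine isClosed_iInter fun x => isClosed_iInter fun _ => ?_
    have hc : Continuous fun f : C₀(X, ℂ) => f x :=
      (BoundedContinuousFunction.lipschitz_eval_const x).continuous.comp
        ZeroAtInftyContinuousMap.isometry_toBCF.continuous
    exact isClosed_eq hc continuous_const

end ClosedIdeal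

/-! ### The embedding of `C₀(G⁽⁰⁾)` -/

namespace EtaleGroupoid

/-- Extension by zero of a compactly supported continuous function along an open embedding. -/
noncomputable def extendByZero {X Y : Type u} [TopologicalSpace X] [TopologicalSpace Y] [T2Space Y]
    {ι : X → Y} (hι : IsOpenEmbedding ι) (f : C_c(X, ℂ)) : C_c(Y, ℂ) where
  toFun := Function.extend ι f 0
  continuous_toFun := continuous_of_tsupport fun y hy => by
    obtain ⟨x, -, rfl⟩ := f.hasCompactSupport.tsupport_extend_zero_subset hι.continuous hy
    rw [← hι.continuousAt_iff, Function.extend_comp hι.injective]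
    exact f.continuous.continuousAt
  hasCompactSupport' := f.hasCompactSupport.extend_zero hι.continuous

lemma extendByZero_apply {X Y : Type u} [TopologicalSpace X] [TopologicalSpace Y] [T2Space Y]
    {ι : X → Y} (hι : IsOpenEmbedding ι) (f : C_c(X, ℂ)) (x : X) :
    extendByZero hι f (ι x) = f x :=
  hι.injective.extend_apply f 0 x

lemma extendByZero_apply_notMem {X Y : Type u} [TopologicalSpace X] [TopologicalSpace Y] [T2Space Y]
    {ι : X → Y} (hι : IsOpenEmbedding ι) (f : C_c(X, ℂ)) {y : Y} (hy : y ∉ Set.range ι) :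
    extendByZero hι f y = 0 :=
  Function.extend_apply' _ _ _ hy

section Diagonal

variable {G : Type u} [TopologicalSpace G] [EtaleGroupoid G]

open Classical in
/-- The diagonal matrix with entries `f(r(g))`, `g ∈ G_u`. -/
noncomputable def diagMatrix (f : C₀(UnitSpace G, ℂ)) (v : UnitSpace G) : Fib v → Fib v → ℂ :=
  fun i j => if i = j then f (r i.1) else 0

lemma norm_apply_le_C0 {X : Type u} [TopologicalSpace X] (f : C₀(X, ℂ)) (x : X) : ‖f x‖ ≤ ‖f‖ := by
  rw [← ZeroAtInftyContinuousMap.norm_toBCF_eq_norm]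
  exact f.toBCF.norm_coe_le_norm x

lemma diagMatrix_schurBound (f : C₀(UnitSpace G, ℂ)) (v : UnitSpace G) :
    SchurBound (diagMatrix f v) ‖f‖ 1 where
  nonneg := norm_nonneg _
  le i j := by
    unfold diagMatrix
    split_ifs
    · exact norm_apply_le_C0 f _
    · rw [norm_zero]; exact norm_nonneg _
  row i := by
    rw [Nat.cast_one, Set.encard_le_one_iff]
    intro a b ha hb
    have h1 : i = a := by by_contra h; exact ha (if_neg h)
    have h2 : i = b := by by_contra h; exact hb (if_neg h)
    exact h1.symm.trans h2
  col j := by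
    rw [Nat.cast_one, Set.encard_le_one_iff]
    intro a b ha hb
    have h1 : a = j := by by_contra h; exact ha (if_neg h)
    have h2 : b = j := by by_contra h; exact hb (if_neg h)
    exact h1.trans h2.symm

lemma diag_op_apply (f : C₀(UnitSpace G, ℂ)) (v : UnitSpace G) (ξ : ℓ²(Fib v, ℂ)) (i : Fib v) :
    (diagMatrix_schurBound f v).op ξ i = f (r i.1) * ξ i := by
  rw [SchurBound.op_apply, tsum_eq_single i]
  · rw [diagMatrix, if_pos rfl]
  · intro j hj
    rw [diagMatrix, if_neg hj.symm, zero_mul]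

/-- The action of `C₀(G⁽⁰⁾)` on `⨁_u ℓ²(G_u)`, given by `(f ξ)(g) = f(r(g)) ξ(g)`. -/
noncomputable def diagOps : C₀(UnitSpace G, ℂ) →⋆ₙₐ[ℂ] OpAlg G where
  toFun f := OpAlg.mk (fun v => (diagMatrix_schurBound f v).op) ‖f‖ fun v => by
    simpa using (diagMatrix_schurBound f v).norm_op_le
  map_smul' c f := by
    refine OpAlg.ext fun v => ?_
    ext ξ i
    change (diagMatrix_schurBound (c • f) v).op ξ i = c * (diagMatrix_schurBound f v).op ξ i
    simp only [diag_op_apply, ZeroAtInftyContinuousMap.smul_apply, smul_eq_mul, mul_assoc]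
  map_zero' := by
    refine OpAlg.ext fun v => ?_
    ext ξ i
    change (diagMatrix_schurBound 0 v).op ξ i = 0
    simp only [diag_op_apply, ZeroAtInftyContinuousMap.zero_apply, zero_mul]
  map_add' f f' := by
    refine OpAlg.ext fun v => ?_
    ext ξ i
    change (diagMatrix_schurBound (f + f') v).op ξ i =
      (diagMatrix_schurBound f v).op ξ i + (diagMatrix_schurBound f' v).op ξ i
    simp only [diag_op_apply, ZeroAtInftyContinuousMap.add_apply, add_mul]
  map_mul' f f' := by
    refine OpAlg.ext fun v => ?_
    ext ξ i
    change (diagMatrix_schurBound (f * f') v).op ξ i =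
      (diagMatrix_schurBound f v).op ((diagMatrix_schurBound f' v).op ξ) i
    simp only [diag_op_apply, ZeroAtInftyContinuousMap.mul_apply, mul_assoc]
  map_star' f := by
    refine OpAlg.ext fun v => ?_
    change (diagMatrix_schurBound (star f) v).op = star (diagMatrix_schurBound f v).op
    refine ((diagMatrix_schurBound f v).adjoint_op (diagMatrix_schurBound (star f) v)
      fun i j => ?_).symm
    unfold diagMatrix
    by_cases h : i = j
    · subst h; simp
    · rw [if_neg h, if_neg fun e => h e.symm, star_zero]

lemma diagOps_apply (f : C₀(UnitSpace G, ℂ)) (v : UnitSpace G) (ξ : ℓ²(Fib v, ℂ)) (i : Fib v) :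
    (diagOps f).proj v ξ i = f (r i.1) * ξ i := diag_op_apply f v ξ i

lemma div_mem_unitSet {v : UnitSpace G} {i j : Fib v} : div i j ∈ unitSet G ↔ i = j := by
  refine ⟨fun h => ?_, fun h => h ▸ (r i.1).2⟩
  have h1 : (r (div i j) : G) = div i j := mem_unitSet_iff.1 h
  rw [r_div] at h1
  exact div_right_inj ((div_self i).trans h1)

variable [T2Space G]

lemma regRep_extendByZero (f : C_c(UnitSpace G, ℂ)) :
    regRep (extendByZero (isOpen_unitSet (G := G)).isOpenEmbedding_subtypeVal f) =
      diagOps (⟨f.toContinuousMap, zero_at_infty f⟩ : C₀(UnitSpace G, ℂ)) := by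
  refine OpAlg.ext fun v => ?_
  ext ξ i
  rw [diagOps_apply, regRep_proj, regRepAt_apply, tsum_eq_single i]
  · congr 1
    exact extendByZero_apply _ f (r i.1)
  · intro j hj
    rw [extendByZero_apply_notMem, zero_mul]
    rintro ⟨y, e⟩
    exact hj (div_mem_unitSet.1 (e ▸ y.2)).symm

variable [LocallyCompactSpace G]

lemma diagOps_mem (f : C₀(UnitSpace G, ℂ)) : diagOps f ∈ reducedSubalgebra G := by
  change diagOps f ∈ closure (regRange G : Set (OpAlg G))
  rw [Metric.mem_closure_iff]
  intro ε hε
  have hK : ∃ K : Set (UnitSpace G), IsCompact K ∧ ∀ x ∉ K, ‖f x‖ < ε / 2 := by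
    have h1 := (zero_at_infty f).norm
    rw [norm_zero] at h1
    obtain ⟨K, hK, h⟩ := Filter.mem_cocompact.1 (h1.eventually (gt_mem_nhds (half_pos hε)))
    exact ⟨K, hK, fun x hx => h hx⟩
  obtain ⟨K, hK, hfK⟩ := hK
  obtain ⟨φ, hφ1, -, hφc, hφ⟩ := exists_continuous_one_zero_of_isCompact hK isClosed_empty
    (Set.disjoint_empty K)
  let f' : C_c(UnitSpace G, ℂ) :=
    { toFun := fun x => (φ x : ℂ) * f x
      continuous_toFun := (Complex.continuous_ofReal.comp φ.continuous).mul f.continuous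
      hasCompactSupport' := (hφc.comp_left (g := fun t : ℝ => (t : ℂ)) Complex.ofReal_zero).mul_right }
  refine ⟨_, ⟨extendByZero (isOpen_unitSet (G := G)).isOpenEmbedding_subtypeVal f', rfl⟩, ?_⟩
  rw [regRep_extendByZero, dist_eq_norm, ← map_sub]
  refine lt_of_le_of_lt ?_ (half_lt_self hε)
  refine (NonUnitalStarAlgHom.norm_apply_le _ _).trans ?_
  rw [← ZeroAtInftyContinuousMap.norm_toBCF_eq_norm,
    BoundedContinuousFunction.norm_le (half_pos hε).le]
  intro x
  change ‖f x - (φ x : ℂ) * f x‖ ≤ ε / 2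
  by_cases hx : x ∈ K
  · have : φ x = 1 := hφ1 hx
    rw [this]
    simpa using (half_pos hε).le
  · have h2 : f x - (φ x : ℂ) * f x = ((1 - φ x : ℝ) : ℂ) * f x := by push_cast; ring
    rw [h2, norm_mul, Complex.norm_real, Real.norm_of_nonneg (by linarith [(hφ x).2])]
    calc (1 - φ x) * ‖f x‖ ≤ 1 * ‖f x‖ :=
          mul_le_mul_of_nonneg_right (by linarith [(hφ x).1]) (norm_nonneg _)
      _ ≤ ε / 2 := by rw [one_mul]; exact (hfK x hx).le

/-- The canonical embedding `C₀(G⁽⁰⁾) → C_r^*(G)`; it extends the map `C_c(G⁽⁰⁾) → C_c(G)` that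
extends functions by zero. -/
noncomputable def ofC0 : C₀(UnitSpace G, ℂ) →⋆ₙₐ[ℂ] ReducedCStar G :=
  NonUnitalStarAlgHom.codRestrict diagOps (reducedSubalgebra G) diagOps_mem

lemma ofC0_eq_ofCc (f : C_c(UnitSpace G, ℂ)) :
    ofC0 (⟨f.toContinuousMap, zero_at_infty f⟩ : C₀(UnitSpace G, ℂ)) =
      ofCc (extendByZero (isOpen_unitSet (G := G)).isOpenEmbedding_subtypeVal f) :=
  Subtype.ext (regRep_extendByZero f).symm

end Diagonal

/-! ### Invariant sets and the map `I ↦ U_I` -/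

noncomputable section Invariant

variable {G : Type u} [TopologicalSpace G] [EtaleGroupoid G]

/-- Invariant sets of units. -/
def IsInvariant (D : Set (UnitSpace G)) : Prop := ∀ g : G, d g ∈ D → r g ∈ D

variable (G) in
/-- The open invariant subsets of `G⁽⁰⁾`. -/
def InvariantOpens : Type u :=
  {U : TopologicalSpace.Opens (UnitSpace G) // IsInvariant (U : Set (UnitSpace G))}

/-- The lattice of open invariant sets, with union and intersection. -/
instance : Lattice (InvariantOpens G) :=
  Subtype.lattice (P := fun U : TopologicalSpace.Opens (UnitSpace G) =>
      IsInvariant (U : Set (UnitSpace G)))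
    (fun _ _ hU hV g hg => hg.imp (hU g) (hV g))
    (fun _ _ hU hV g hg => ⟨hU g hg.1, hV g hg.2⟩)

/-- The topology on the open invariant sets that is induced by the Fell topology of the space of
closed ideals of `C₀(G⁽⁰⁾)`, open sets being identified with these ideals. -/
instance : TopologicalSpace (InvariantOpens G) :=
  TopologicalSpace.induced (fun U => ClosedIdeal.ofOpens U.1) ClosedIdeal.fellTopology

variable [T2Space G] [LocallyCompactSpace G]

/-- The set `U_I`: the union of the sets `{f ≠ 0}`, `f ∈ I ∩ C₀(G⁽⁰⁾)`. -/
def idealSupport (I : ClosedIdeal (ReducedCStar G)) : Set (UnitSpace G) :=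
  ⋃ f ∈ {f : C₀(UnitSpace G, ℂ) | ofC0 f ∈ I}, {x | f x ≠ 0}

lemma isOpen_idealSupport (I : ClosedIdeal (ReducedCStar G)) : IsOpen (idealSupport I) :=
  isOpen_biUnion fun f _ => isOpen_ne.preimage f.continuous

lemma isInvariant_idealSupport (I : ClosedIdeal (ReducedCStar G)) :
    IsInvariant (idealSupport I) := by
  classical
  intro g hg
  obtain ⟨f, hf, hfg⟩ := Set.mem_iUnion₂.1 hg
  obtain ⟨S, hS, hgS⟩ := exists_bisection g
  have hSr : ∀ {x y}, x ∈ S → y ∈ S → r x = r y → x = y := fun {x y} hx hy e =>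
    congrArg Subtype.val (hS.r_isOpenEmbedding.injective
      (a₁ := ⟨x, hx⟩) (a₂ := ⟨y, hy⟩) (congrArg Subtype.val e))
  have hSd : ∀ {x y}, x ∈ S → y ∈ S → d x = d y → x = y := fun {x y} hx hy e =>
    congrArg Subtype.val (hS.d_isOpenEmbedding.injective
      (a₁ := ⟨x, hx⟩) (a₂ := ⟨y, hy⟩) (congrArg Subtype.val e))
  obtain ⟨φ, hφ1, hφ0, hφc, -⟩ := exists_continuous_one_zero_of_isCompact
    (isCompact_singleton (x := g)) hS.isOpen.isClosed_compl
    (Set.disjoint_singleton_left.2 fun h => h hgS)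
  let ψ : C_c(G, ℂ) :=
    { toFun := fun x => (φ x : ℂ)
      continuous_toFun := Complex.continuous_ofReal.comp φ.continuous
      hasCompactSupport' := hφc.comp_left (g := fun t : ℝ => (t : ℂ)) Complex.ofReal_zero }
  have hψg : ψ g = 1 := by
    have : φ g = 1 := hφ1 rfl
    change (φ g : ℂ) = 1
    rw [this, Complex.ofReal_one]
  have hψS : ∀ {x}, ψ x ≠ 0 → x ∈ S := fun {x} hx => by
    by_contra h
    have : φ x = 0 := hφ0 h
    exact hx (by change (φ x : ℂ) = 0; rw [this, Complex.ofReal_zero])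
  let F : G → UnitSpace G → ℂ := fun h x => if r h = x then ψ h * f (d h) * star (ψ h) else 0
  have hFK : ∀ h x, F h x ≠ 0 → ψ h ≠ 0 ∧ r h = x := fun h x hne => by
    by_cases c : r h = x
    · refine ⟨fun h0 => hne ?_, c⟩
      simp only [F, if_pos c, h0, zero_mul]
    · exact absurd (if_neg c) hne
  have hcont : Continuous fun x => ∑' h, F h x := by
    refine continuous_fiber_sum isLocalHomeomorph_r (q := (Subtype.val : UnitSpace G → G))
      continuous_subtype_val ?_ ψ.hasCompactSupport
      (fun h x hne => subset_tsupport _ (hFK h x hne).1)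
      (fun h x hne => congrArg Subtype.val (hFK h x hne).2)
    have h1 : Continuous fun z : G × UnitSpace G => ψ z.1 * f (d z.1) * star (ψ z.1) :=
      ((ψ.continuous.comp continuous_fst).mul
        (f.continuous.comp (continuous_d.comp continuous_fst))).mul
        (continuous_star.comp (ψ.continuous.comp continuous_fst))
    refine h1.continuousOn.congr fun z hz => ?_
    exact if_pos (Subtype.ext hz)
  let f₀ : C_c(UnitSpace G, ℂ) :=
    { toFun := fun x => ∑' h, F h x
      continuous_toFun := hcont
      hasCompactSupport' := by
        refine HasCompactSupport.intro (ψ.hasCompactSupport.isCompact.image continuous_r)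
          fun x hx => ?_
        refine (tsum_congr fun h => ?_).trans tsum_zero
        by_contra hne
        exact hx ⟨h, subset_tsupport _ (hFK h x hne).1, (hFK h x hne).2⟩ }
  let f₁ : C₀(UnitSpace G, ℂ) := ⟨f₀.toContinuousMap, zero_at_infty f₀⟩
  have hf₁ : f₁ (r g) ≠ 0 := by
    have : f₁ (r g) = f (d g) := by
      change ∑' h, F h (r g) = _
      rw [tsum_eq_single g]
      · simp only [F, if_pos, hψg, one_mul, star_one, mul_one]
      · intro h hh
        by_contra hne
        obtain ⟨h1, h2⟩ := hFK h _ hne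
        exact hh (hSr (hψS h1) hgS h2)
    rw [this]; exact hfg
  have key : ofC0 f₁ = ofCc ψ * ofC0 f * star (ofCc ψ) := by
    apply Subtype.ext
    change diagOps f₁ = regRep ψ * diagOps f * star (regRep ψ)
    rw [star_regRep]
    refine OpAlg.ext fun v => ?_
    ext ξ i
    change (diagOps f₁).proj v ξ i =
      regRepAt ψ v ((diagOps f).proj v (regRepAt (involution ψ) v ξ)) i
    rw [diagOps_apply, regRepAt_apply]
    simp only [diagOps_apply, regRepAt_apply]
    have h1 : ∀ j : Fib v, ψ (div i j) * (f (r j.1) *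
        ∑' k, involution ψ (div j k) * ξ k) = F (div i j) (r i.1) * ξ i := by
      intro j
      have hF : F (div i j) (r i.1) = ψ (div i j) * f (r j.1) * star (ψ (div i j)) := by
        simp only [F, r_div, d_div, if_true]
      rw [hF]
      by_cases h0 : ψ (div i j) = 0
      · simp only [h0, zero_mul]
      · rw [tsum_eq_single i]
        · change ψ (div i j) * (f (r j.1) * (star (ψ (inv (div j i))) * ξ i)) = _
          rw [GroupoidSet.inv_div]
          ring
        · intro k hk
          change star (ψ (inv (div j k))) * ξ k = 0
          rw [GroupoidSet.inv_div]
          by_contra hne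
          have hk0 : ψ (div k j) ≠ 0 := fun h => hne (by rw [h, star_zero, zero_mul])
          exact hk (div_left_inj (hSd (hψS hk0) (hψS h0) (by rw [d_div, d_div])))
    simp only [h1]
    rw [tsum_mul_right]
    congr 1
    change ∑' h, F h (r i.1) = _
    rw [← tsum_subtype_eq_of_support_subset (f := fun h => F h (r i.1)) (s := {h | r h = r i.1})]
    · exact ((divEquiv i).tsum_eq fun h => F h.1 (r i.1)).symm
    · exact fun h hh => (hFK h _ hh).2
  refine Set.mem_biUnion (x := f₁) ?_ hf₁
  change ofC0 f₁ ∈ I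
  rw [key]
  exact I.mul_mem_right _ (I.mul_mem_left _ hf)

/-- The map `Θ : I ↦ U_I` from closed ideals to open invariant sets. -/
def idealToOpens (I : ClosedIdeal (ReducedCStar G)) : InvariantOpens G :=
  ⟨⟨idealSupport I, isOpen_idealSupport I⟩, isInvariant_idealSupport I⟩

end Invariant

end EtaleGroupoid

/-! ### Reductions to locally closed invariant sets -/

namespace EtaleGroupoid

section Reindex

variable {I J : Type u}

/-- The unitary `ℓ²(I) → ℓ²(J)` that is induced by a bijection `I → J`. -/
noncomputable def reindex (e : I ≃ J) : ℓ²(I, ℂ) ≃ₗᵢ[ℂ] ℓ²(J, ℂ) where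
  toFun ξ := ⟨fun j => ξ (e.symm j), memℓp_gen (((lp.memℓp ξ).summable (by simp)).comp_injective
    e.symm.injective)⟩
  invFun ξ := ⟨fun i => ξ (e i), memℓp_gen (((lp.memℓp ξ).summable (by simp)).comp_injective
    e.injective)⟩
  left_inv ξ := by ext i; exact congrArg ξ (e.symm_apply_apply i)
  right_inv ξ := by ext j; exact congrArg ξ (e.apply_symm_apply j)
  map_add' ξ η := by ext; rfl
  map_smul' c ξ := by ext; rfl
  norm_map' ξ := by
    rw [lp.norm_eq_tsum_rpow (by simp), lp.norm_eq_tsum_rpow (by simp)]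
    congr 1
    exact e.symm.tsum_eq fun i => ‖ξ i‖ ^ (2 : ℝ≥0∞).toReal

lemma reindex_apply (e : I ≃ J) (ξ : ℓ²(I, ℂ)) (j : J) : reindex e ξ j = ξ (e.symm j) := rfl

lemma reindex_symm_apply (e : I ≃ J) (ξ : ℓ²(J, ℂ)) (i : I) : (reindex e).symm ξ i = ξ (e i) := rfl

end Reindex

variable {G : Type u} [TopologicalSpace G] [EtaleGroupoid G]

variable (G) in
/-- Locally closed invariant sets of units (for instance the closed and the open ones). -/
structure LCInvariant where
  carrier : Set (UnitSpace G)
  invariant : IsInvariant carrier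
  isLocallyClosed : IsLocallyClosed carrier

/-- A closed invariant set. -/
def LCInvariant.ofClosed (D : Set (UnitSpace G)) (hD : IsClosed D) (hi : IsInvariant D) :
    LCInvariant G := ⟨D, hi, hD.isLocallyClosed⟩

lemma IsInvariant.compl {D : Set (UnitSpace G)} (hi : IsInvariant D) : IsInvariant Dᶜ := by
  intro g hg hg'
  have := hi (inv g) (by rw [d_inv]; exact hg')
  rw [r_inv] at this
  exact hg this

/-- The complement of a closed invariant set. -/
def LCInvariant.complOfClosed (D : Set (UnitSpace G)) (hD : IsClosed D) (hi : IsInvariant D) :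
    LCInvariant G := ⟨Dᶜ, hi.compl, hD.isOpen_compl.isLocallyClosed⟩

/-- The reduction `G_D = {g | d(g) ∈ D}` to an invariant set `D`. -/
@[ext]
structure Reduction (D : LCInvariant G) : Type u where
  val : G
  mem : d val ∈ D.carrier

namespace Reduction

variable (D : LCInvariant G)

/-- The subspace topology. -/
instance : TopologicalSpace (Reduction D) := TopologicalSpace.induced val inferInstance

/-- The groupoid structure inherited from `G`. -/
instance : GroupoidSet (Reduction D) where
  Comp g h := Comp g.val h.val
  mul g h c := ⟨mul g.val h.val c, by rw [d_mul]; exact h.mem⟩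
  inv g := ⟨inv g.val, by rw [d_inv]; exact D.invariant _ g.mem⟩
  assoc g₁ g₂ g₃ h₁₂ h₂₃ := by
    obtain ⟨c, c', e⟩ := assoc g₁.val g₂.val g₃.val h₁₂ h₂₃
    exact ⟨c, c', Reduction.ext e⟩
  comp_inv g := comp_inv g.val
  inv_mul_cancel g h c := by
    obtain ⟨c', e⟩ := inv_mul_cancel g.val h.val c
    exact ⟨c', Reduction.ext e⟩
  mul_inv_cancel g h c := by
    obtain ⟨c', e⟩ := mul_inv_cancel g.val h.val c
    exact ⟨c', Reduction.ext e⟩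

variable {D}

lemma isEmbedding_val : IsEmbedding (val : Reduction D → G) := ⟨⟨rfl⟩, fun _ _ => Reduction.ext⟩

lemma continuous_val : Continuous (val : Reduction D → G) := isEmbedding_val.continuous

lemma range_val : Set.range (val : Reduction D → G) = d ⁻¹' D.carrier :=
  Set.ext fun g => ⟨fun ⟨h, e⟩ => e ▸ h.mem, fun h => ⟨⟨g, h⟩, rfl⟩⟩

instance [T2Space G] : T2Space (Reduction D) := isEmbedding_val.t2Space

instance [LocallyCompactSpace G] : LocallyCompactSpace (Reduction D) :=
  isEmbedding_val.isInducing.locallyCompactSpace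
    (by rw [range_val]; exact D.isLocallyClosed.preimage continuous_d)

lemma r_val (g : Reduction D) : (r g : Reduction D).val = (r g.val : G) := rfl
lemma d_val (g : Reduction D) : (d g : Reduction D).val = (d g.val : G) := rfl

lemma isOpenEmbedding_aux {S : Set G} {p : G → G} {p' : Reduction D → Reduction D}
    (hp : ∀ g, (p' g).val = p g.val) (hpD : ∀ g : G, d (p g) ∈ D.carrier → d g ∈ D.carrier)
    (h : IsOpenEmbedding (S.domRestrict p)) :
    IsOpenEmbedding ((val ⁻¹' S : Set (Reduction D)).domRestrict p') := by
  refine .of_continuous_injective_isOpenMap ?_ ?_ ?_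
  · rw [isEmbedding_val.continuous_iff]
    have : Continuous fun g : (val ⁻¹' S : Set (Reduction D)) =>
        S.domRestrict p ⟨g.1.val, g.2⟩ :=
      h.continuous.comp ((continuous_val.comp continuous_subtype_val).subtype_mk _)
    exact this.congr fun g => (hp g.1).symm
  · intro a b hab
    have : S.domRestrict p ⟨a.1.val, a.2⟩ = S.domRestrict p ⟨b.1.val, b.2⟩ :=
      (hp a.1).symm.trans ((congrArg val hab).trans (hp b.1))
    have h2 := h.injective this
    exact Subtype.ext (Reduction.ext (congrArg Subtype.val h2))
  · intro W hW
    obtain ⟨W', hW', rfl⟩ := isOpen_induced_iff.1 hW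
    obtain ⟨V, hV, rfl⟩ := isOpen_induced_iff.1 hW'
    have : (val ⁻¹' S : Set (Reduction D)).domRestrict p' '' (Subtype.val ⁻¹' (val ⁻¹' V)) =
        val ⁻¹' (S.domRestrict p '' (Subtype.val ⁻¹' V)) := by
      ext x
      constructor
      · rintro ⟨g, hg, rfl⟩
        exact ⟨⟨g.1.val, g.2⟩, hg, (hp g.1).symm⟩
      · rintro ⟨g, hg, hgx⟩
        have hgx' : p g.1 = x.val := hgx
        have hx : d x.val ∈ D.carrier := x.mem
        rw [← hgx'] at hx
        exact ⟨⟨⟨g.1, hpD _ hx⟩, g.2⟩, hg, Reduction.ext ((hp _).trans hgx')⟩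
    rw [this]
    exact (h.isOpenMap _ (hV.preimage continuous_subtype_val)).preimage continuous_val

/-- The reduction to a locally closed invariant set is an étale groupoid. -/
instance : EtaleGroupoid (Reduction D) where
  continuous_mul := by
    rw [isEmbedding_val.continuous_iff]
    exact (EtaleGroupoid.continuous_mul (G := G)).comp
      (f := fun p : {p : Reduction D × Reduction D // Comp p.1 p.2} =>
        (⟨(p.1.1.val, p.1.2.val), p.2⟩ : {p : G × G // Comp p.1 p.2}))
      (Continuous.subtype_mk (f := fun p : {p : Reduction D × Reduction D // Comp p.1 p.2} =>
        (p.1.1.val, p.1.2.val))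
        ((continuous_val.comp (continuous_fst.comp continuous_subtype_val)).prodMk
          (continuous_val.comp (continuous_snd.comp continuous_subtype_val))) _)
  continuous_inv := by
    rw [isEmbedding_val.continuous_iff]
    exact EtaleGroupoid.continuous_inv.comp continuous_val
  isTopologicalBasis := by
    refine TopologicalSpace.isTopologicalBasis_of_isOpen_of_nhds (fun S hS => hS.isOpen) ?_
    intro a W ha hW
    obtain ⟨V, hV, rfl⟩ := isOpen_induced_iff.1 hW
    obtain ⟨S, hS, haS, hSV⟩ :=
      (EtaleGroupoid.isTopologicalBasis (G := G)).exists_subset_of_mem_open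
        (show a.val ∈ V from ha) hV
    refine ⟨val ⁻¹' S, ⟨hS.isOpen.preimage continuous_val, ?_, ?_⟩, haS, Set.preimage_mono hSV⟩
    · refine isOpenEmbedding_aux (p := fun g => (r g : G)) (fun g => rfl) (fun g hg => ?_)
        hS.r_isOpenEmbedding
      rw [d_coe_unit] at hg
      have := D.invariant (inv g) (by rw [d_inv]; exact hg)
      rwa [r_inv] at this
    · refine isOpenEmbedding_aux (p := fun g => (d g : G)) (fun g => rfl) (fun g hg => ?_)
        hS.d_isOpenEmbedding
      rwa [d_coe_unit] at hg

/-- The inclusion of unit spaces `(G_D)⁽⁰⁾ = D → G⁽⁰⁾`. -/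
def unitIncl (v : UnitSpace (Reduction D)) : UnitSpace G := d v.1.val

lemma unitIncl_coe (v : UnitSpace (Reduction D)) : (unitIncl v : G) = v.1.val :=
  congrArg (fun w : UnitSpace (Reduction D) => w.1.val) (d_coe_unit v)

lemma unitIncl_mem (v : UnitSpace (Reduction D)) : unitIncl v ∈ D.carrier := v.1.mem

/-- An element of `D` as a unit of `G_D`. -/
def unitLift (u : UnitSpace G) (hu : u ∈ D.carrier) : UnitSpace (Reduction D) :=
  d (⟨u, by rwa [d_coe_unit]⟩ : Reduction D)

lemma unitIncl_unitLift (u : UnitSpace G) (hu : u ∈ D.carrier) : unitIncl (unitLift u hu) = u := by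
  apply Subtype.ext
  rw [unitIncl_coe]
  exact congrArg Subtype.val (d_coe_unit u)

/-- The fibres of `G_D` are fibres of `G`. -/
def fibEquiv {v : UnitSpace (Reduction D)} {u : UnitSpace G} (h : unitIncl v = u) :
    Fib v ≃ Fib u where
  toFun g := ⟨g.1.val, by
    apply Subtype.ext
    rw [← h, unitIncl_coe]
    exact congrArg (fun w : UnitSpace (Reduction D) => w.1.val) g.2⟩
  invFun g := ⟨⟨g.1, by rw [g.2, ← h]; exact unitIncl_mem v⟩, by
      apply Subtype.ext; apply Reduction.ext
      change (d g.1 : G) = v.1.val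
      rw [g.2, ← h, unitIncl_coe]⟩
  left_inv _ := rfl
  right_inv _ := rfl

lemma div_fibEquiv {v : UnitSpace (Reduction D)} {u : UnitSpace G} (h : unitIncl v = u)
    (i j : Fib v) : div (fibEquiv h i) (fibEquiv h j) = (div i j).val := rfl

/-- Conjugation with the unitary `ℓ²(I) → ℓ²(J)` that is induced by a bijection `I → J`. -/
noncomputable def conjReindex {I J : Type u} (e : I ≃ J) :
    (ℓ²(I, ℂ) →L[ℂ] ℓ²(I, ℂ)) ≃⋆ₐ[ℂ] (ℓ²(J, ℂ) →L[ℂ] ℓ²(J, ℂ)) :=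
  (reindex e).conjStarAlgEquiv

lemma conjReindex_apply {I J : Type u} (e : I ≃ J) (T : ℓ²(I, ℂ) →L[ℂ] ℓ²(I, ℂ)) (ξ : ℓ²(J, ℂ))
    (j : J) : conjReindex e T ξ j = T ((reindex e).symm ξ) (e.symm j) := rfl

lemma norm_conjReindex_le {I J : Type u} (e : I ≃ J) (T : ℓ²(I, ℂ) →L[ℂ] ℓ²(I, ℂ)) :
    ‖conjReindex e T‖ ≤ ‖T‖ := NonUnitalStarAlgHom.norm_apply_le (conjReindex e) T

/-- Restriction of a family of operators to the units in `D`. -/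
noncomputable def restrictOps (D : LCInvariant G) : OpAlg G →⋆ₙₐ[ℂ] OpAlg (Reduction D) where
  toFun x := OpAlg.mk (fun v => conjReindex (fibEquiv (v := v) rfl).symm (x.proj (unitIncl v))) ‖x‖
    fun v => (norm_conjReindex_le _ _).trans (x.norm_proj_le _)
  map_smul' c x := OpAlg.ext fun v => by
    simp only [OpAlg.proj_mk, OpAlg.proj_smul, MonoidHom.id_apply]
    exact map_smul (conjReindex (fibEquiv (v := v) rfl).symm) c (x.proj (unitIncl v))
  map_zero' := OpAlg.ext fun v => by
    simp only [OpAlg.proj_mk, OpAlg.proj_zero]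
    exact map_zero (conjReindex (fibEquiv (v := v) rfl).symm)
  map_add' x y := OpAlg.ext fun v => by
    simp only [OpAlg.proj_mk, OpAlg.proj_add]
    exact map_add (conjReindex (fibEquiv (v := v) rfl).symm) _ _
  map_mul' x y := OpAlg.ext fun v => by
    simp only [OpAlg.proj_mk, OpAlg.proj_mul]
    exact map_mul (conjReindex (fibEquiv (v := v) rfl).symm) _ _
  map_star' x := OpAlg.ext fun v => by
    simp only [OpAlg.proj_mk, OpAlg.proj_star]
    exact map_star (conjReindex (fibEquiv (v := v) rfl).symm) _

open Classical in
/-- The component at `u` of the extension by zero of a family of operators on the fibres of `G_D`. -/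
noncomputable def extendAt (y : OpAlg (Reduction D)) (u : UnitSpace G) :
    ℓ²(Fib u, ℂ) →L[ℂ] ℓ²(Fib u, ℂ) :=
  if hu : u ∈ D.carrier then conjReindex (fibEquiv (unitIncl_unitLift u hu)) (y.proj (unitLift u hu))
  else 0

lemma extendAt_mem (y : OpAlg (Reduction D)) {u : UnitSpace G} (hu : u ∈ D.carrier) :
    extendAt y u = conjReindex (fibEquiv (unitIncl_unitLift u hu)) (y.proj (unitLift u hu)) :=
  dif_pos hu

lemma extendAt_notMem (y : OpAlg (Reduction D)) {u : UnitSpace G} (hu : u ∉ D.carrier) :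
    extendAt y u = 0 := dif_neg hu

lemma norm_extendAt_le (y : OpAlg (Reduction D)) (u : UnitSpace G) : ‖extendAt y u‖ ≤ ‖y‖ := by
  by_cases hu : u ∈ D.carrier
  · rw [extendAt_mem y hu]
    exact (norm_conjReindex_le _ _).trans (y.norm_proj_le _)
  · rw [extendAt_notMem y hu, norm_zero]
    exact norm_nonneg _

/-- Extension of a family of operators on the fibres of `G_D` by zero outside `D`. -/
noncomputable def extendOps (D : LCInvariant G) : OpAlg (Reduction D) →⋆ₙₐ[ℂ] OpAlg G where
  toFun y := OpAlg.mk (fun u => extendAt y u) ‖y‖ (norm_extendAt_le y)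
  map_smul' c x := OpAlg.ext fun u => by
    simp only [OpAlg.proj_mk, OpAlg.proj_smul, MonoidHom.id_apply]
    by_cases hu : u ∈ D.carrier
    · simp only [extendAt_mem _ hu, OpAlg.proj_smul]
      exact map_smul (conjReindex (fibEquiv (unitIncl_unitLift u hu))) c _
    · simp only [extendAt_notMem _ hu, smul_zero]
  map_zero' := OpAlg.ext fun u => by
    simp only [OpAlg.proj_mk, OpAlg.proj_zero]
    by_cases hu : u ∈ D.carrier
    · simp only [extendAt_mem _ hu, OpAlg.proj_zero]
      exact map_zero (conjReindex (fibEquiv (unitIncl_unitLift u hu)))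
    · simp only [extendAt_notMem _ hu]
  map_add' x y := OpAlg.ext fun u => by
    simp only [OpAlg.proj_mk, OpAlg.proj_add]
    by_cases hu : u ∈ D.carrier
    · simp only [extendAt_mem _ hu, OpAlg.proj_add]
      exact map_add (conjReindex (fibEquiv (unitIncl_unitLift u hu))) _ _
    · simp only [extendAt_notMem _ hu, add_zero]
  map_mul' x y := OpAlg.ext fun u => by
    simp only [OpAlg.proj_mk, OpAlg.proj_mul]
    by_cases hu : u ∈ D.carrier
    · simp only [extendAt_mem _ hu, OpAlg.proj_mul]
      exact map_mul (conjReindex (fibEquiv (unitIncl_unitLift u hu))) _ _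
    · simp only [extendAt_notMem _ hu, mul_zero]
  map_star' x := OpAlg.ext fun u => by
    simp only [OpAlg.proj_mk, OpAlg.proj_star]
    by_cases hu : u ∈ D.carrier
    · simp only [extendAt_mem _ hu, OpAlg.proj_star]
      exact map_star (conjReindex (fibEquiv (unitIncl_unitLift u hu))) _
    · simp only [extendAt_notMem _ hu, star_zero]

lemma isClosedEmbedding_val (hD : IsClosed D.carrier) :
    IsClosedEmbedding (val : Reduction D → G) :=
  ⟨isEmbedding_val, by rw [range_val]; exact hD.preimage continuous_d⟩

lemma isOpenEmbedding_val (hD : IsOpen D.carrier) : IsOpenEmbedding (val : Reduction D → G) :=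
  ⟨isEmbedding_val, by rw [range_val]; exact hD.preimage continuous_d⟩

/-- Restriction `C_c(G) → C_c(G_D)` for closed `D`. -/
noncomputable def restrictCc (hD : IsClosed D.carrier) (f : C_c(G, ℂ)) : C_c(Reduction D, ℂ) where
  toFun g := f g.val
  continuous_toFun := f.continuous.comp continuous_val
  hasCompactSupport' := f.hasCompactSupport.comp_isClosedEmbedding (isClosedEmbedding_val hD)

lemma restrictOps_regRep (hD : IsClosed D.carrier) (f : C_c(G, ℂ)) :
    restrictOps D (regRep f) = regRep (restrictCc hD f) := by
  refine OpAlg.ext fun v => ?_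
  ext ξ i
  change conjReindex (fibEquiv (v := v) rfl).symm (regRepAt f (unitIncl v)) ξ i =
    regRepAt (restrictCc hD f) v ξ i
  rw [conjReindex_apply, Equiv.symm_symm, regRepAt_apply, regRepAt_apply,
    ← (fibEquiv (v := v) rfl).tsum_eq]
  refine tsum_congr fun k => ?_
  rw [reindex_symm_apply, Equiv.symm_apply_apply, div_fibEquiv]
  rfl

variable [T2Space G]

lemma extendOps_regRep (hD : IsOpen D.carrier) (f : C_c(Reduction D, ℂ)) :
    extendOps D (regRep f) = regRep (extendByZero (isOpenEmbedding_val hD) f) := by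
  refine OpAlg.ext fun u => ?_
  ext ξ i
  change extendAt (regRep f) u ξ i =
    regRepAt (extendByZero (isOpenEmbedding_val hD) f) u ξ i
  by_cases hu : u ∈ D.carrier
  · rw [extendAt_mem _ hu]
    rw [conjReindex_apply, regRep_proj, regRepAt_apply, regRepAt_apply,
      ← (fibEquiv (unitIncl_unitLift u hu)).tsum_eq]
    refine tsum_congr fun k => ?_
    obtain ⟨i, rfl⟩ := (fibEquiv (unitIncl_unitLift u hu)).surjective i
    rw [reindex_symm_apply, Equiv.symm_apply_apply, div_fibEquiv, extendByZero_apply]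
  · rw [extendAt_notMem _ hu, regRepAt_apply]
    refine Eq.symm ((tsum_congr fun k => ?_).trans tsum_zero)
    rw [extendByZero_apply_notMem, zero_mul]
    rw [range_val]
    intro h
    have h1 : r k.1 ∈ D.carrier := by rw [← d_div i k]; exact h
    have h2 := D.invariant (inv k.1) (by rw [d_inv]; exact h1)
    rw [r_inv, k.2] at h2
    exact hu h2

/-- The canonical map `C_r^*(G) → C_r^*(G_D)` for a closed invariant set `D`; it extends the
restriction map `C_c(G) → C_c(G_D)`. -/
noncomputable def restrictHom (hD : IsClosed D.carrier) :
    ReducedCStar G →⋆ₙₐ[ℂ] ReducedCStar (Reduction D) :=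
  NonUnitalStarAlgHom.codRestrict
    ((restrictOps D).comp (NonUnitalStarSubalgebraClass.subtype (reducedSubalgebra G)))
    (reducedSubalgebra (Reduction D)) fun x => by
      have hc : Continuous (restrictOps D) := AddMonoidHomClass.continuous_of_bound
        (restrictOps D) 1 fun x => by
          rw [one_mul]; exact NonUnitalStarAlgHom.norm_apply_le _ _
      have hx : x.1 ∈ closure (regRange G : Set (OpAlg G)) := x.2
      change restrictOps D x.1 ∈ closure (regRange (Reduction D) : Set (OpAlg (Reduction D)))
      refine map_mem_closure hc hx ?_
      rintro _ ⟨f, rfl⟩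
      exact ⟨restrictCc hD f, (restrictOps_regRep hD f).symm⟩

lemma restrictHom_ofCc (hD : IsClosed D.carrier) (f : C_c(G, ℂ)) :
    restrictHom hD (ofCc f) = ofCc (restrictCc hD f) := Subtype.ext (restrictOps_regRep hD f)

/-- The canonical map `C_r^*(G_U) → C_r^*(G)` for an open invariant set `U`; it extends the map
`C_c(G_U) → C_c(G)` that extends functions by zero. -/
noncomputable def extendHom (hU : IsOpen D.carrier) :
    ReducedCStar (Reduction D) →⋆ₙₐ[ℂ] ReducedCStar G :=
  NonUnitalStarAlgHom.codRestrict
    ((extendOps D).comp (NonUnitalStarSubalgebraClass.subtype (reducedSubalgebra (Reduction D))))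
    (reducedSubalgebra G) fun x => by
      have hc : Continuous (extendOps D) := AddMonoidHomClass.continuous_of_bound
        (extendOps D) 1 fun x => by
          rw [one_mul]; exact NonUnitalStarAlgHom.norm_apply_le _ _
      have hx : x.1 ∈ closure (regRange (Reduction D) : Set (OpAlg (Reduction D))) := x.2
      change extendOps D x.1 ∈ closure (regRange G : Set (OpAlg G))
      refine map_mem_closure hc hx ?_
      rintro _ ⟨f, rfl⟩
      exact ⟨extendByZero (isOpenEmbedding_val hU) f, (extendOps_regRep hU f).symm⟩

lemma extendHom_ofCc (hU : IsOpen D.carrier) (f : C_c(Reduction D, ℂ)) :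
    extendHom hU (ofCc f) = ofCc (extendByZero (isOpenEmbedding_val hU) f) :=
  Subtype.ext (extendOps_regRep hU f)

end Reduction

/-! ### Inner exactness and the residual intersection property -/

section Properties

variable (G : Type u) [TopologicalSpace G] [EtaleGroupoid G] [T2Space G]

/-- `G` is inner exact: for each closed invariant set `D`, with complement `U`, the sequence
`0 → C_r^*(G_U) → C_r^*(G) → C_r^*(G_D) → 0` is exact. -/
def IsInnerExact : Prop :=
  ∀ (D : Set (UnitSpace G)) (hD : IsClosed D) (hi : IsInvariant D),
    let j : ReducedCStar (Reduction (LCInvariant.complOfClosed D hD hi)) →⋆ₙₐ[ℂ] ReducedCStar G :=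
      Reduction.extendHom hD.isOpen_compl
    let π : ReducedCStar G →⋆ₙₐ[ℂ] ReducedCStar (Reduction (LCInvariant.ofClosed D hD hi)) :=
      Reduction.restrictHom hD
    Function.Injective j ∧ Function.Exact j π ∧ Function.Surjective π

variable [LocallyCompactSpace G]

/-- The intersection property: each non-zero closed ideal of `C_r^*(G)` contains a non-zero element
of `C₀(G⁽⁰⁾)`. -/
def HasIntersectionProperty : Prop :=
  ∀ I : ClosedIdeal (ReducedCStar G), (∃ x ∈ I, x ≠ 0) → ∃ f : C₀(UnitSpace G, ℂ), f ≠ 0 ∧ ofC0 f ∈ I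

/-- The residual intersection property: `G_D` has the intersection property for each closed
invariant set `D`. -/
def HasResidualIntersectionProperty : Prop :=
  ∀ (D : Set (UnitSpace G)) (hD : IsClosed D) (hi : IsInvariant D),
    HasIntersectionProperty (Reduction (LCInvariant.ofClosed D hD hi))

/-- `C₀(G⁽⁰⁾)` separates the ideals of `C_r^*(G)`: the map `I ↦ U_I` is injective. -/
def SeparatesIdeals : Prop :=
  Function.Injective (idealToOpens : ClosedIdeal (ReducedCStar G) → InvariantOpens G)

end Properties

end EtaleGroupoid

/-! Every open invariant set `U` gives rise to two closed ideals of `C_r^*(G)`. `supportedIdeal U`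
is the closure of the functions in `C_c(G)` supported in `G_U`; `vanishingIdeal U` is the common
kernel of the regular representations at units outside `U`. The first is contained in the second,
and `Θ` takes the value `U` on both (`idealToOpens_supportedIdeal`, `idealToOpens_vanishingIdeal`).
So `Θ` is always surjective, and conditions 1 and 2 agree. Moreover `supportedIdeal U` is the least
closed ideal whose support contains `U` (`supportedIdeal_le_of_le`).

Let `D` be the complement of `U`. The image of `C_r^*(G_U)` in `C_r^*(G)` is `supportedIdeal U`, and
the kernel of the restriction to `C_r^*(G_D)` is `vanishingIdeal U`. The outer parts of exactness
are automatic: extension by zero is injective because restriction undoes it, and restriction is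
surjective because it has dense range (Tietze) and homomorphisms of C*-algebras have closed range.
Thus inner exactness says precisely that the two ideals coincide for every `U`.

If `Θ` is injective, the two ideals coincide because they have the same support. If an ideal of
`C_r^*(G_D)` meets `C₀(D)` only in zero, then its preimage in `C_r^*(G)` has the same support as the
kernel of the restriction; so it is that kernel, and the ideal is zero. This is the residual
intersection property.

Conversely, let `U` be the support of an ideal `I`. Inner exactness places the kernel of the
restriction to `D` inside `I`. A non-zero image of `I` in `C_r^*(G_D)` would contain a non-zero
function on `D`; an extension of it to `G⁽⁰⁾` would lie in `I` and be non-zero somewhere outside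
`U`, which is absurd. Hence `I = vanishingIdeal U` (`eq_vanishingIdeal`), so `I` is determined by
its support. Then `Θ` and `vanishingIdeal` are mutually inverse monotone maps, and each pulls back
subbasic open sets of the Fell topologies to subbasic ones. -/

namespace NonUnitalStarAlgHom

/-! ### Closed range of homomorphisms of C*-algebras -/

section ClosedRange

variable {A B : Type*} [NonUnitalCStarAlgebra A] [NonUnitalCStarAlgebra B]

lemma continuous_of_cstar (φ : A →⋆ₙₐ[ℂ] B) : Continuous φ :=
  AddMonoidHomClass.continuous_of_bound φ 1 fun x => by
    rw [one_mul]; exact NonUnitalStarAlgHom.norm_apply_le φ x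

/-- A self-adjoint element of the range has a preimage whose norm is at most its own. -/
lemma exists_eq_norm_le_of_isSelfAdjoint (φ : A →⋆ₙₐ[ℂ] B) {a : A} (ha : IsSelfAdjoint a) :
    ∃ a', φ a' = φ a ∧ ‖a'‖ ≤ ‖φ a‖ := by
  set M : ℝ := ‖φ a‖
  have hM : 0 ≤ M := norm_nonneg _
  -- Truncation to `[-M, M]`. The spectrum of `φ a` lies in this interval, so `f` fixes `φ a` under
  -- the functional calculus, while `f(a)` has norm at most `M`.
  let f : ℝ → ℝ := fun t => max (-M) (min t M)
  have hf : Continuous f := by fun_prop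
  have hf0 : f 0 = 0 := by simp [f, hM]
  refine ⟨cfcₙ f a, ?_, norm_cfcₙ_le fun t _ => ?_⟩
  · rw [NonUnitalStarAlgHomClass.map_cfcₙ (S := ℂ) φ f a hf.continuousOn hf0
      φ.continuous_of_cstar ha (ha.map φ)]
    conv_rhs => rw [← cfcₙ_id ℝ (φ a) (ha.map φ)]
    refine cfcₙ_congr fun t ht => ?_
    have h1 : ‖t‖ ≤ M := by
      have := norm_apply_le_norm_cfcₙ (fun t : ℝ => t) (φ a) ht (ha := ha.map φ)
      rwa [cfcₙ_id' ℝ (φ a) (ha.map φ)] at this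
    rw [Real.norm_eq_abs, abs_le] at h1
    simp [f, h1.1, h1.2]
  · rw [Real.norm_eq_abs, abs_le]
    exact ⟨le_max_left _ _, max_le (by linarith) (min_le_right _ _)⟩

/-- Real and imaginary parts are lifted separately, which costs the factor 2. The value of the
constant is immaterial: any uniform bound forces the range to be closed. -/
lemma exists_eq_norm_le (φ : A →⋆ₙₐ[ℂ] B) (a : A) :
    ∃ a', φ a' = φ a ∧ ‖a'‖ ≤ 2 * ‖φ a‖ := by
  obtain ⟨x, hx, hxn⟩ := φ.exists_eq_norm_le_of_isSelfAdjoint (realPart a).2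
  obtain ⟨y, hy, hyn⟩ := φ.exists_eq_norm_le_of_isSelfAdjoint (imaginaryPart a).2
  have hsmul (c : ℝ) (x : A) : φ (c • x) = c • φ x := by
    rw [← Complex.coe_smul, map_smul, Complex.coe_smul]
  have h1 : φ (realPart a) = realPart (φ a) := by
    simp only [realPart_apply_coe, hsmul, map_add, map_star]
  have h2 : φ (imaginaryPart a) = imaginaryPart (φ a) := by
    simp only [imaginaryPart_apply_coe, hsmul, map_smul, map_sub, map_star]
  refine ⟨x + Complex.I • y, ?_, ?_⟩
  · rw [map_add, map_smul, hx, hy, h1, h2, realPart_add_I_smul_imaginaryPart]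
  · have := norm_add_le x (Complex.I • y)
    rw [norm_smul, Complex.norm_I, one_mul] at this
    have h3 := realPart.norm_le (φ a)
    have h4 := imaginaryPart.norm_le (φ a)
    rw [h1] at hxn
    rw [h2] at hyn
    have h5 : ‖(realPart (φ a) : B)‖ ≤ ‖φ a‖ := h3
    have h6 : ‖(imaginaryPart (φ a) : B)‖ ≤ ‖φ a‖ := h4
    linarith

/-- A homomorphism of C*-algebras with dense range is surjective. -/
lemma surjective_of_denseRange (φ : A →⋆ₙₐ[ℂ] B) (hφ : DenseRange φ) :
    Function.Surjective φ := by
  let ψ : NormedAddGroupHom A B :=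
    (AddMonoidHomClass.toAddMonoidHom φ).mkNormedAddGroupHom 1 fun x => by
      rw [one_mul]; exact NonUnitalStarAlgHom.norm_apply_le φ x
  -- With norm-controlled preimages, an element of the closure of the range is the image of an
  -- absolutely convergent series; `ε = 1` is arbitrary slack.
  have h := controlled_closure_of_complete (f := ψ)
    (K := (AddMonoidHomClass.toAddMonoidHom φ).range) (C := 2) (ε := 1)
    (by norm_num) (by norm_num) (by
      rintro _ ⟨a, rfl⟩
      exact φ.exists_eq_norm_le a)
  intro b
  obtain ⟨a, ha, -⟩ := h b (hφ b)
  exact ⟨a, ha⟩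

end ClosedRange

end NonUnitalStarAlgHom

/-! ### Extension and separation by compactly supported functions -/

/-- Tietze extension for compactly supported functions on a closed subspace of a locally compact
Hausdorff space. -/
lemma CompactlySupportedContinuousMap.exists_extension {X Y : Type*} [TopologicalSpace X]
    [TopologicalSpace Y] [T2Space Y] [LocallyCompactSpace Y] {e : X → Y} (he : IsClosedEmbedding e)
    (f : C_c(X, ℂ)) : ∃ F : C_c(Y, ℂ), ∀ x, F (e x) = f x := by
  classical
  obtain ⟨φ, hφ1, -, hφc, -⟩ := exists_continuous_one_zero_of_isCompact
    (f.hasCompactSupport.isCompact.image he.continuous) isClosed_empty (Set.disjoint_empty _)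
  -- The whole space need not be normal, so Tietze is applied on the compact set `L`. The cut-off
  -- `φ` is supported in the interior of `L`, hence `φ g` extends continuously by zero.
  obtain ⟨L, hL, hφL⟩ := exists_compact_superset hφc.isCompact
  have : CompactSpace L := isCompact_iff_compactSpace.1 hL
  have he' : IsClosedEmbedding (L.restrictPreimage e) := he.restrictPreimage L
  obtain ⟨g, hg⟩ := ContinuousMap.exists_extension he'
    (f.toContinuousMap.comp ⟨(Subtype.val : (e ⁻¹' L) → X), continuous_subtype_val⟩)
  let F : Y → ℂ := fun y => if h : y ∈ L then (φ y : ℂ) * g ⟨y, h⟩ else 0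
  have hFφ : ∀ y, φ y = 0 → F y = 0 := fun y hy => by
    by_cases h : y ∈ L <;> simp [F, h, hy]
  have hsupp : tsupport F ⊆ tsupport φ :=
    closure_mono fun y hy hy' => hy (hFφ y hy')
  refine ⟨{ toFun := F, continuous_toFun := ?_, hasCompactSupport' := ?_ }, fun x => ?_⟩
  · refine continuous_of_tsupport fun y hy => ?_
    have hyL := hφL (hsupp hy)
    have hc : ContinuousOn F L := by
      rw [continuousOn_iff_continuous_domRestrict]
      refine ((Complex.continuous_ofReal.comp
        (φ.continuous.comp continuous_subtype_val)).mul g.continuous).congr fun z => ?_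
      simp [F]
    exact hc.continuousAt (mem_interior_iff_mem_nhds.1 hyL)
  · exact hφc.isCompact.of_isClosed_subset (isClosed_tsupport _) hsupp
  · change F (e x) = f x
    -- Where `f x = 0` the value of the cut-off at `e x` is unknown but irrelevant; elsewhere it is
    -- 1.
    by_cases hx : f x = 0
    · by_cases h : e x ∈ L
      · have := DFunLike.congr_fun hg ⟨x, h⟩
        have h2 : g ⟨e x, h⟩ = f x := this
        simp [F, h, h2, hx]
      · simp [F, h, hx]
    · have hxt : e x ∈ e '' tsupport f := ⟨x, subset_tsupport _ hx, rfl⟩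
      have h1 : φ (e x) = 1 := hφ1 hxt
      have h : e x ∈ L := interior_subset (hφL (subset_tsupport _ (by simp [h1])))
      have h2 : g ⟨e x, h⟩ = f x := DFunLike.congr_fun hg ⟨x, h⟩
      simp [F, h, h2, h1]

/-- A complex-valued Urysohn function for a compact set in an open set. -/
lemma exists_compactlySupported_one_of_isCompact {X : Type*} [TopologicalSpace X] [T2Space X]
    [LocallyCompactSpace X] {K U : Set X} (hK : IsCompact K) (hU : IsOpen U) (hKU : K ⊆ U) :
    ∃ f : C_c(X, ℂ), (∀ x ∈ K, f x = 1) ∧ tsupport f ⊆ U := by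
  -- The intermediate compact set keeps the closed support inside `U`, and not only the set where
  -- the function is non-zero.
  obtain ⟨L, hL, hKL, hLU⟩ := exists_compact_between hK hU hKU
  obtain ⟨φ, hφ1, hφ0, hφc, -⟩ := exists_continuous_one_zero_of_isCompact hK
    isOpen_interior.isClosed_compl (Set.disjoint_left.2 fun x hx hx' => hx' (hKL hx))
  refine ⟨⟨⟨fun x => (φ x : ℂ), Complex.continuous_ofReal.comp φ.continuous⟩,
    hφc.comp_left (g := fun t : ℝ => (t : ℂ)) Complex.ofReal_zero⟩, fun x hx => ?_, ?_⟩
  · have : φ x = 1 := hφ1 hx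
    change (φ x : ℂ) = 1
    rw [this, Complex.ofReal_one]
  · refine (closure_minimal (fun x hx => ?_) hL.isClosed).trans hLU
    by_contra h
    have : φ x = 0 := hφ0 fun h' => h (interior_subset h')
    exact hx (by change (φ x : ℂ) = 0; rw [this, Complex.ofReal_zero])

/-! ### The two closed ideals attached to an open invariant set -/

namespace EtaleGroupoid
open GroupoidSet

variable {G : Type u} [TopologicalSpace G] [EtaleGroupoid G]

lemma OpAlg.continuous_proj (v : UnitSpace G) : Continuous fun x : OpAlg G => x.proj v :=
  (LipschitzWith.of_dist_le_mul (K := 1) fun x y => by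
    rw [NNReal.coe_one, one_mul, dist_eq_norm, dist_eq_norm]
    exact OpAlg.norm_proj_le (x - y) v).continuous

lemma IsInvariant.r_mem_iff {D : Set (UnitSpace G)} (hi : IsInvariant D) (g : G) :
    r g ∈ D ↔ d g ∈ D := by
  refine ⟨fun h => ?_, hi g⟩
  have := hi (inv g) (by rwa [d_inv])
  rwa [r_inv] at this

variable [T2Space G]

noncomputable instance : NonUnitalCStarAlgebra (ReducedCStar G) :=
  have : IsClosed ((reducedSubalgebra G : NonUnitalStarSubalgebra ℂ (OpAlg G)) : Set (OpAlg G)) :=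
    NonUnitalStarSubalgebra.isClosed_topologicalClosure _
  inferInstanceAs (NonUnitalCStarAlgebra (reducedSubalgebra G))

lemma denseRange_ofCc : DenseRange (ofCc : C_c(G, ℂ) → ReducedCStar G) := by
  intro x
  rw [Topology.IsEmbedding.subtypeVal.closure_eq_preimage_closure_image, ← Set.range_comp]
  exact x.2

lemma ofCc_mul (f f' : C_c(G, ℂ)) : ofCc f * ofCc f' = ofCc (convolution f f') :=
  Subtype.ext (regRep_mul f f')

/-- The closed ideal of all elements that vanish in the regular representations at units outside
`U`. -/
noncomputable def vanishingIdeal (U : InvariantOpens G) : ClosedIdeal (ReducedCStar G) where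
  carrier := {a | ∀ u ∉ U.1, a.1.proj u = 0}
  add_mem' ha hb u hu := by
    change (_ : OpAlg G).proj u + (_ : OpAlg G).proj u = 0
    rw [ha u hu, hb u hu, add_zero]
  zero_mem' _ _ := rfl
  smul_mem' c a ha u hu := by
    change c • (_ : OpAlg G).proj u = 0
    rw [ha u hu, smul_zero]
  mul_mem_left' a x hx u hu := by
    change (_ : OpAlg G).proj u * (_ : OpAlg G).proj u = 0
    rw [hx u hu, mul_zero]
  mul_mem_right' a x hx u hu := by
    change (_ : OpAlg G).proj u * (_ : OpAlg G).proj u = 0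
    rw [hx u hu, zero_mul]
  isClosed' := by
    simp only [Set.ofPred_forall]
    exact isClosed_iInter fun u => isClosed_iInter fun _ =>
      isClosed_eq ((OpAlg.continuous_proj u).comp continuous_subtype_val) continuous_const

lemma mem_vanishingIdeal {U : InvariantOpens G} {a : ReducedCStar G} :
    a ∈ vanishingIdeal U ↔ ∀ u ∉ U.1, a.1.proj u = 0 := Iff.rfl

lemma vanishingIdeal_mono {U V : InvariantOpens G} (h : U ≤ V) :
    vanishingIdeal U ≤ vanishingIdeal V := fun _ ha u hu => ha u fun hu' => hu (h hu')

/-- The functions in `C_c(G)` with support in the reduction to `U`, as elements of `C_r^*(G)`. -/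
noncomputable def supportedSubmodule (U : InvariantOpens G) : Submodule ℂ (ReducedCStar G) where
  carrier := ofCc '' {f : C_c(G, ℂ) | tsupport f ⊆ d ⁻¹' U.1}
  add_mem' := by
    rintro _ _ ⟨f, hf, rfl⟩ ⟨f', hf', rfl⟩
    exact ⟨f + f', (tsupport_add f f').trans (union_subset hf hf'),
      Subtype.ext (map_add regRep f f')⟩
  zero_mem' := ⟨0, by simp, Subtype.ext (map_zero regRep)⟩
  smul_mem' := by
    rintro c _ ⟨f, hf, rfl⟩
    exact ⟨c • f, (closure_mono (Function.support_const_smul_subset c f)).trans hf,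
      Subtype.ext (map_smul regRep c f)⟩

lemma convolution_apply (f f' : C_c(G, ℂ)) (g : G) : convolution f f' g =
    ∑' h : {h : G // r h = r g}, f h.1 * f' (mul (inv h.1) g (by rw [comp_iff, d_inv, h.2])) := rfl

/-- A non-zero term `f(h) f'(h⁻¹ g)` puts `h⁻¹ g` in the support of `f'`, and `d(h⁻¹ g) = d(g)`. The
image of a compact support is closed, so the bound survives passing to the closure. This makes
`C_c(G_U)` a left ideal; the companion for `r` makes it a right ideal. -/
lemma tsupport_convolution_subset_d (f f' : C_c(G, ℂ)) :
    tsupport (convolution f f') ⊆ d ⁻¹' (d '' tsupport f') := by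
  refine closure_minimal (fun g hg => ?_)
    ((f'.hasCompactSupport.isCompact.image continuous_d).isClosed.preimage continuous_d)
  by_contra h
  refine hg ?_
  rw [convolution_apply]
  refine (tsum_congr fun x => ?_).trans tsum_zero
  rw [image_eq_zero_of_notMem_tsupport (f := f'), mul_zero]
  exact fun hx => h ⟨_, hx, d_mul _ _ _⟩

lemma tsupport_convolution_subset_r (f f' : C_c(G, ℂ)) :
    tsupport (convolution f f') ⊆ r ⁻¹' (r '' tsupport f) := by
  refine closure_minimal (fun g hg => ?_)
    ((f.hasCompactSupport.isCompact.image continuous_r).isClosed.preimage continuous_r)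
  by_contra h
  refine hg ?_
  rw [convolution_apply]
  refine (tsum_congr fun x => ?_).trans tsum_zero
  rw [image_eq_zero_of_notMem_tsupport (f := f), zero_mul]
  exact fun hx => h ⟨_, hx, x.2⟩

/-- The closed ideal that is generated by `C_c(G_U)`. -/
noncomputable def supportedIdeal (U : InvariantOpens G) : ClosedIdeal (ReducedCStar G) where
  toSubmodule := (supportedSubmodule U).topologicalClosure
  mul_mem_left' a {x} hx := by
    refine map_mem_closure₂ _root_.continuous_mul (denseRange_ofCc a) hx ?_
    rintro _ ⟨f, rfl⟩ _ ⟨f', hf', rfl⟩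
    refine ⟨_, fun g hg => ?_, (ofCc_mul f f').symm⟩
    obtain ⟨g', hg', e⟩ := tsupport_convolution_subset_d f f' hg
    change d g ∈ U.1
    rw [← e]
    exact hf' hg'
  mul_mem_right' a {x} hx := by
    refine map_mem_closure₂ _root_.continuous_mul hx (denseRange_ofCc a) ?_
    rintro _ ⟨f, hf, rfl⟩ _ ⟨f', rfl⟩
    refine ⟨_, fun g hg => ?_, (ofCc_mul f f').symm⟩
    obtain ⟨g', hg', e⟩ := tsupport_convolution_subset_r f f' hg
    change d g ∈ (U.1 : Set (UnitSpace G))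
    -- Multiplication on the right is controlled through ranges, and invariance of `U` translates
    -- between `r` and `d`.
    rw [← U.2.r_mem_iff, ← e]
    exact U.2 _ (hf hg')
  isClosed' := Submodule.isClosed_topologicalClosure _

lemma supportedIdeal_le_iff {U : InvariantOpens G} {I : ClosedIdeal (ReducedCStar G)} :
    supportedIdeal U ≤ I ↔ ∀ f : C_c(G, ℂ), tsupport f ⊆ d ⁻¹' U.1 → ofCc f ∈ I := by
  refine ⟨fun h f hf => h (subset_closure ⟨f, hf, rfl⟩), fun h => ?_⟩
  refine closure_minimal ?_ I.isClosed'
  rintro _ ⟨f, hf, rfl⟩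
  exact h f hf

/-- The matrix entries of `π_u(f)` are the values `f(i k⁻¹)` with `i, k ∈ G_u`, and `d(i k⁻¹) =
r(k)` lies in the orbit of `u`. If `u ∉ U`, this orbit misses `U` and all entries vanish. -/
lemma supportedIdeal_le_vanishingIdeal (U : InvariantOpens G) :
    supportedIdeal U ≤ vanishingIdeal U := by
  refine supportedIdeal_le_iff.2 fun f hf u hu => ?_
  ext ξ i
  change regRepAt f u ξ i = 0
  rw [regRepAt_apply]
  refine (tsum_congr fun k => ?_).trans tsum_zero
  rw [image_eq_zero_of_notMem_tsupport (f := f), zero_mul]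
  intro h
  have h1 : r k.1 ∈ (U.1 : Set (UnitSpace G)) := by rw [← d_div i k]; exact hf h
  rw [U.2.r_mem_iff, k.2] at h1
  exact hu h1

/-! ### Supports of ideals -/

variable [LocallyCompactSpace G]

/-- A compactly supported function as a function that vanishes at infinity. -/
abbrev ofCompactSupport {X : Type*} [TopologicalSpace X] (f : C_c(X, ℂ)) : C₀(X, ℂ) :=
  ⟨f.toContinuousMap, zero_at_infty f⟩

/-- On `ℓ²(G_u)` the function `f` acts as multiplication by `f ∘ r`. The basis vector at the unit
`u` recovers `f(u)`; conversely `r` maps `G_u` into the complement of `U` when `u ∉ U`. -/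
lemma ofC0_mem_vanishingIdeal {U : InvariantOpens G} {f : C₀(UnitSpace G, ℂ)} :
    ofC0 f ∈ vanishingIdeal U ↔ ∀ u ∉ U.1, f u = 0 := by
  classical
  constructor
  · intro h u hu
    have h1 := diagOps_apply f u (lp.single 2 ⟨u, d_coe_unit u⟩ 1) ⟨u, d_coe_unit u⟩
    rw [lp.single_apply_self, mul_one, r_coe_unit] at h1
    rw [← h1]
    have h2 : (diagOps f).proj u = 0 := h u hu
    rw [h2]
    rfl
  · intro h u hu
    ext ξ i
    change (diagOps f).proj u ξ i = 0
    rw [diagOps_apply, h, zero_mul]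
    intro hr
    have h1 : d i.1 ∈ (U.1 : Set (UnitSpace G)) := (U.2.r_mem_iff i.1).1 hr
    rw [i.2] at h1
    exact hu h1

lemma mem_idealSupport {I : ClosedIdeal (ReducedCStar G)} {u : UnitSpace G} :
    u ∈ idealSupport I ↔ ∃ f : C₀(UnitSpace G, ℂ), ofC0 f ∈ I ∧ f u ≠ 0 := by
  simp [idealSupport]

lemma mem_idealToOpens {I : ClosedIdeal (ReducedCStar G)} {u : UnitSpace G} :
    u ∈ (idealToOpens I).1 ↔ ∃ f : C₀(UnitSpace G, ℂ), ofC0 f ∈ I ∧ f u ≠ 0 := mem_idealSupport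

lemma idealToOpens_mono : Monotone (idealToOpens : ClosedIdeal (ReducedCStar G) → _) :=
  fun _ _ h _ hu => by
    obtain ⟨f, hf, hfu⟩ := mem_idealToOpens.1 hu
    exact mem_idealToOpens.2 ⟨f, h hf, hfu⟩

lemma ofC0_mem_supportedIdeal {U : InvariantOpens G} {f : C_c(UnitSpace G, ℂ)}
    (hf : tsupport f ⊆ U.1) : ofC0 (ofCompactSupport f) ∈ supportedIdeal U := by
  rw [ofC0_eq_ofCc]
  refine subset_closure ⟨_, ?_, rfl⟩
  intro g hg
  obtain ⟨u, hu, rfl⟩ := f.hasCompactSupport.tsupport_extend_zero_subset continuous_subtype_val hg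
  change d (u : G) ∈ U.1
  rw [d_coe_unit]
  exact hf hu

lemma idealToOpens_supportedIdeal_ge (U : InvariantOpens G) :
    U ≤ idealToOpens (supportedIdeal U) := by
  intro u hu
  obtain ⟨f, hf1, hf⟩ := exists_compactlySupported_one_of_isCompact (isCompact_singleton (x := u))
    U.1.isOpen (singleton_subset_iff.2 hu)
  refine mem_idealToOpens.2 ⟨_, ofC0_mem_supportedIdeal hf, ?_⟩
  have : f u = 1 := hf1 u rfl
  change f u ≠ 0
  rw [this]
  exact one_ne_zero

/-- The support of the supported ideal contains `U` by Urysohn, and functions on units in the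
vanishing ideal vanish outside `U`. By monotonicity both ideals, and every ideal between them, have
support exactly `U`. -/
lemma idealToOpens_vanishingIdeal (U : InvariantOpens G) :
    idealToOpens (vanishingIdeal U) = U := by
  refine le_antisymm (fun u hu => ?_) ((idealToOpens_supportedIdeal_ge U).trans
    (idealToOpens_mono (supportedIdeal_le_vanishingIdeal U)))
  obtain ⟨f, hf, hfu⟩ := mem_idealToOpens.1 hu
  by_contra h
  exact hfu (ofC0_mem_vanishingIdeal.1 hf u h)

lemma idealToOpens_supportedIdeal (U : InvariantOpens G) :
    idealToOpens (supportedIdeal U) = U :=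
  le_antisymm ((idealToOpens_mono (supportedIdeal_le_vanishingIdeal U)).trans
    (idealToOpens_vanishingIdeal U).le) (idealToOpens_supportedIdeal_ge U)

lemma idealToOpens_surjective :
    Function.Surjective (idealToOpens : ClosedIdeal (ReducedCStar G) → InvariantOpens G) :=
  fun U => ⟨_, idealToOpens_vanishingIdeal U⟩

/-- A closed ideal contains the compactly supported functions on its support. -/
lemma ofC0_mem_of_tsupport_subset {I : ClosedIdeal (ReducedCStar G)} {f : C_c(UnitSpace G, ℂ)}
    (hf : tsupport f ⊆ idealSupport I) : ofC0 (ofCompactSupport f) ∈ I := by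
  -- By compactness one function `h` in the ideal has no zero on the support of `f`; then `f = (f /
  -- h) h`.
  have key : ∃ h : C₀(UnitSpace G, ℂ), ofC0 h ∈ I ∧ (∀ x, 0 ≤ (h x).re) ∧
      ∀ x ∈ tsupport f, 0 < (h x).re := by
    refine f.hasCompactSupport.isCompact.induction_on
      (p := fun s => ∃ h : C₀(UnitSpace G, ℂ), ofC0 h ∈ I ∧ (∀ x, 0 ≤ (h x).re) ∧
        ∀ x ∈ s, 0 < (h x).re) ?_ ?_ ?_ ?_
    · exact ⟨0, by rw [map_zero]; exact Submodule.zero_mem _, fun x => le_rfl, by simp⟩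
    · rintro s t hst ⟨h, h1, h2, h3⟩
      exact ⟨h, h1, h2, fun x hx => h3 x (hst hx)⟩
    · rintro s t ⟨h, h1, h2, h3⟩ ⟨h', h1', h2', h3'⟩
      refine ⟨h + h', by rw [map_add]; exact Submodule.add_mem _ h1 h1', fun x => ?_, ?_⟩
      · exact add_nonneg (h2 x) (h2' x)
      · rintro x (hx | hx)
        · exact add_pos_of_pos_of_nonneg (h3 x hx) (h2' x)
        · exact add_pos_of_nonneg_of_pos (h2 x) (h3' x hx)
    · intro x hx
      obtain ⟨h, hI, hx0⟩ := mem_idealSupport.1 (hf hx)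
      -- Local functions are replaced by `|h|²`, so that no cancellation occurs when they are added
      -- up.
      have e : ∀ y, ((star h * h) y).re = Complex.normSq (h y) := fun y => by
        change (star (h y) * h y).re = _
        rw [Complex.star_def, ← Complex.normSq_eq_conj_mul_self, Complex.ofReal_re]
      refine ⟨{y | h y ≠ 0}, mem_nhdsWithin_of_mem_nhds
        ((isOpen_ne.preimage h.continuous).mem_nhds hx0), star h * h, ?_,
        fun y => ?_, fun y hy => ?_⟩
      · rw [map_mul]; exact I.mul_mem_left _ hI
      · rw [e]; exact Complex.normSq_nonneg _
      · rw [e]; exact Complex.normSq_pos.2 hy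
  obtain ⟨h, hI, -, hpos⟩ := key
  have hne : ∀ x ∈ tsupport f, h x ≠ 0 := fun x hx h0 => by
    have := hpos x hx
    rw [h0] at this
    exact lt_irrefl _ this
  -- Off the support of `f` the quotient is 0 even at zeros of `h`, so continuity only has to be
  -- checked where `h ≠ 0`.
  have hsub : tsupport (fun x => f x / h x) ⊆ tsupport f :=
    closure_mono fun x hx hx0 => hx (by simp only [hx0, zero_div])
  let q : C_c(UnitSpace G, ℂ) :=
    { toFun := fun x => f x / h x
      continuous_toFun := continuous_of_tsupport fun x hx =>
        f.continuous.continuousAt.div h.continuous.continuousAt (hne x (hsub hx))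
      hasCompactSupport' :=
        f.hasCompactSupport.isCompact.of_isClosed_subset (isClosed_tsupport _) hsub }
  have : ofCompactSupport f = ofCompactSupport q * h := by
    ext x
    change f x = f x / h x * h x
    by_cases hx : f x = 0
    · simp [hx]
    · rw [div_mul_cancel₀ _ (hne x (subset_tsupport _ hx))]
  rw [this, map_mul]
  exact I.mul_mem_left _ hI

/-- Left multiplication by `φ` multiplies `f(g)` by `φ(r(g))`. Such local units carry membership in
an ideal from functions on units to functions on `G`. -/
lemma ofC0_mul_ofCc_of_eq_one {φ : C₀(UnitSpace G, ℂ)} {f : C_c(G, ℂ)}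
    (h : ∀ u ∈ r '' tsupport f, φ u = 1) : ofC0 φ * ofCc f = ofCc f := by
  apply Subtype.ext
  change diagOps φ * regRep f = regRep f
  refine OpAlg.ext fun v => ?_
  ext ξ i
  change (diagOps φ).proj v (regRepAt f v ξ) i = regRepAt f v ξ i
  rw [diagOps_apply, regRepAt_apply, ← tsum_mul_left]
  refine tsum_congr fun k => ?_
  by_cases hk : f (div i k) = 0
  · rw [hk, zero_mul, mul_zero]
  · rw [h _ ⟨_, subset_tsupport _ hk, r_div i k⟩, one_mul]

/-- For `f` supported in `G_U`, invariance puts the compact set `r(supp f)` inside `U`. A function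
`φ` supported in `U` that is 1 there belongs to `I`, hence so does `f = φ f`. -/
lemma supportedIdeal_le_of_le {U : InvariantOpens G} {I : ClosedIdeal (ReducedCStar G)}
    (h : U ≤ idealToOpens I) : supportedIdeal U ≤ I := by
  refine supportedIdeal_le_iff.2 fun f hf => ?_
  obtain ⟨φ, hφ1, hφ⟩ := exists_compactlySupported_one_of_isCompact
    (f.hasCompactSupport.isCompact.image continuous_r) U.1.isOpen (by
      rintro _ ⟨g, hg, rfl⟩
      exact U.2 g (hf hg))
  rw [← ofC0_mul_ofCc_of_eq_one (φ := ofCompactSupport φ) hφ1]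
  exact I.mul_mem_right _ (ofC0_mem_of_tsupport_subset (hφ.trans h))

end EtaleGroupoid

/-! ### Preimages and images of closed ideals -/

namespace ClosedIdeal

variable {A B : Type u} [NonUnitalCStarAlgebra A] [NonUnitalCStarAlgebra B]

/-- The preimage of a closed ideal under a homomorphism of C*-algebras. -/
def comap (φ : A →⋆ₙₐ[ℂ] B) (J : ClosedIdeal B) : ClosedIdeal A where
  carrier := {a | φ a ∈ J}
  add_mem' ha hb := by
    change φ (_ + _) ∈ J
    rw [map_add]
    exact Submodule.add_mem _ ha hb
  zero_mem' := by
    change φ 0 ∈ J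
    rw [map_zero]
    exact Submodule.zero_mem _
  smul_mem' c a ha := by
    change φ (c • a) ∈ J
    rw [map_smul]
    exact Submodule.smul_mem _ c ha
  mul_mem_left' a x hx := by
    change φ (a * x) ∈ J
    rw [map_mul]
    exact J.mul_mem_left _ hx
  mul_mem_right' a x hx := by
    change φ (x * a) ∈ J
    rw [map_mul]
    exact J.mul_mem_right _ hx
  isClosed' := J.isClosed'.preimage φ.continuous_of_cstar

lemma mem_comap {φ : A →⋆ₙₐ[ℂ] B} {J : ClosedIdeal B} {a : A} : a ∈ comap φ J ↔ φ a ∈ J := Iff.rfl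

/-- The image of a closed ideal that contains the kernel of a surjective homomorphism of
C*-algebras. -/
def map (φ : A →⋆ₙₐ[ℂ] B) (hφ : Function.Surjective φ) (I : ClosedIdeal A)
    (hI : ∀ a, φ a = 0 → a ∈ I) : ClosedIdeal B where
  carrier := φ '' I
  add_mem' := by
    rintro _ _ ⟨a, ha, rfl⟩ ⟨b, hb, rfl⟩
    exact ⟨a + b, Submodule.add_mem _ ha hb, map_add _ _ _⟩
  zero_mem' := ⟨0, Submodule.zero_mem _, map_zero _⟩
  smul_mem' := by
    rintro c _ ⟨a, ha, rfl⟩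
    exact ⟨c • a, Submodule.smul_mem _ c ha, map_smul _ _ _⟩
  mul_mem_left' := by
    rintro b _ ⟨a, ha, rfl⟩
    obtain ⟨b, rfl⟩ := hφ b
    exact ⟨b * a, I.mul_mem_left b ha, map_mul _ _ _⟩
  mul_mem_right' := by
    rintro b _ ⟨a, ha, rfl⟩
    obtain ⟨b, rfl⟩ := hφ b
    exact ⟨a * b, I.mul_mem_right b ha, map_mul _ _ _⟩
  isClosed' := by
    -- By the open mapping theorem `φ` is a quotient map, and since `I` contains the kernel, the
    -- preimage of its image is `I` itself, which is closed.
    let ψ : A →L[ℂ] B := ⟨(φ : A →ₗ[ℂ] B), φ.continuous_of_cstar⟩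
    have hψ : IsQuotientMap φ := (ψ.isOpenMap hφ).isQuotientMap ψ.continuous hφ
    rw [← hψ.isClosed_preimage]
    have : φ ⁻¹' (φ '' I) = I := by
      refine Subset.antisymm ?_ (subset_preimage_image _ _)
      rintro a ⟨b, hb, e⟩
      have h1 : a - b ∈ I := hI _ (by rw [map_sub, e, sub_self])
      rw [← sub_add_cancel a b]
      exact Submodule.add_mem I.toSubmodule h1 hb
    rw [this]
    exact I.isClosed'

lemma apply_mem_map_iff {φ : A →⋆ₙₐ[ℂ] B} {hφ : Function.Surjective φ} {I : ClosedIdeal A}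
    {hI : ∀ a, φ a = 0 → a ∈ I} {a : A} : φ a ∈ map φ hφ I hI ↔ a ∈ I := by
  refine ⟨?_, fun h => ⟨a, h, rfl⟩⟩
  rintro ⟨b, hb, e⟩
  have h1 : a - b ∈ I := hI _ (by rw [map_sub, e, sub_self])
  rw [← sub_add_cancel a b]
  exact Submodule.add_mem I.toSubmodule h1 hb

end ClosedIdeal

/-! ### The sequence of reduced C*-algebras of an invariant set -/

namespace EtaleGroupoid
open GroupoidSet

namespace Reduction

variable {G : Type u} [TopologicalSpace G] [EtaleGroupoid G] {D : LCInvariant G}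

lemma restrictOps_extendOps (y : OpAlg (Reduction D)) : restrictOps D (extendOps D y) = y := by
  refine OpAlg.ext fun v => ?_
  change conjReindex (fibEquiv (v := v) rfl).symm (extendAt y (unitIncl v)) = y.proj v
  rw [extendAt_mem y (unitIncl_mem v)]
  -- The unit obtained by including `v` and lifting it again equals `v` only propositionally, while
  -- the type of the fibre depends on it. Generalising to `w` permits substitution.
  have key : ∀ (w : UnitSpace (Reduction D)) (e : unitIncl w = unitIncl v), w = v →
      conjReindex (fibEquiv (v := v) rfl).symm (conjReindex (fibEquiv e) (y.proj w)) =
        y.proj v := by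
    rintro w e rfl
    ext ξ i
    rfl
  exact key _ _ (Subtype.ext (Reduction.ext (by
    rw [← unitIncl_coe, ← unitIncl_coe, unitIncl_unitLift])))

lemma unitIncl_r (g : Reduction D) : unitIncl (r g) = r g.val := d_coe_unit (r g.val)

lemma coe_comp_unitIncl :
    (Subtype.val : UnitSpace G → G) ∘ (unitIncl : UnitSpace (Reduction D) → _) =
    val ∘ Subtype.val := funext unitIncl_coe

lemma isEmbedding_unitIncl : IsEmbedding (unitIncl : UnitSpace (Reduction D) → UnitSpace G) := by
  refine IsEmbedding.of_comp ?_ continuous_subtype_val ?_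
  · exact (continuous_d.comp continuous_val).comp continuous_subtype_val
  · rw [coe_comp_unitIncl]
    exact isEmbedding_val.comp .subtypeVal

lemma range_unitIncl : Set.range (unitIncl : UnitSpace (Reduction D) → UnitSpace G) = D.carrier :=
  Subset.antisymm (range_subset_iff.2 unitIncl_mem)
    fun u hu => ⟨unitLift u hu, unitIncl_unitLift u hu⟩

lemma isClosedEmbedding_unitIncl (hD : IsClosed D.carrier) :
    IsClosedEmbedding (unitIncl : UnitSpace (Reduction D) → UnitSpace G) :=
  ⟨isEmbedding_unitIncl, by rwa [range_unitIncl]⟩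

lemma restrictOps_eq_zero_iff {x : OpAlg G} :
    restrictOps D x = 0 ↔ ∀ u ∈ D.carrier, x.proj u = 0 := by
  constructor
  · intro h u hu
    obtain ⟨v, rfl⟩ : ∃ v : UnitSpace (Reduction D), unitIncl v = u :=
      ⟨_, unitIncl_unitLift u hu⟩
    have h1 : conjReindex (fibEquiv (v := v) rfl).symm (x.proj (unitIncl v)) = 0 :=
      congrArg (fun y => OpAlg.proj y v) h
    exact (map_eq_zero_iff _ (EquivLike.injective _)).1 h1
  · intro h
    refine OpAlg.ext fun v => ?_
    change conjReindex (fibEquiv (v := v) rfl).symm (x.proj (unitIncl v)) = 0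
    rw [h _ (unitIncl_mem v), map_zero]

variable [T2Space G]

lemma restrictHom_eq_zero_iff (hD : IsClosed D.carrier) {a : ReducedCStar G} :
    restrictHom hD a = 0 ↔ ∀ u ∈ D.carrier, a.1.proj u = 0 := by
  rw [← restrictOps_eq_zero_iff]
  exact Subtype.ext_iff

lemma extendHom_injective (hD : IsOpen D.carrier) : Function.Injective (extendHom hD) :=
  fun x y h => Subtype.ext <| by
    rw [← restrictOps_extendOps x.1, ← restrictOps_extendOps y.1]
    exact congrArg (fun z : ReducedCStar G => restrictOps D z.1) h

lemma isClosed_range_extendHom (hD : IsOpen D.carrier) : IsClosed (Set.range (extendHom hD)) := by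
  have h : Isometry (extendHom hD) := NonUnitalStarAlgHom.isometry _ (extendHom_injective hD)
  exact h.isClosedEmbedding.isClosed_range

/-- The open invariant set to which a groupoid is reduced. -/
def toInvariantOpens (D : LCInvariant G) (hD : IsOpen D.carrier) : InvariantOpens G :=
  ⟨⟨D.carrier, hD⟩, D.invariant⟩

/-- Both sides are closed, the range because an injective homomorphism of C*-algebras is isometric,
and both have the functions in `C_c(G)` supported in the reduction as a dense subset. -/
lemma range_extendHom (hD : IsOpen D.carrier) :
    Set.range (extendHom hD) = supportedIdeal (toInvariantOpens D hD) := by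
  apply Subset.antisymm
  · rintro _ ⟨y, rfl⟩
    have hc : Continuous (extendHom hD) := (extendHom hD).continuous_of_cstar
    refine map_mem_closure hc (denseRange_ofCc y) ?_
    rintro _ ⟨f, rfl⟩
    refine ⟨_, fun g hg => ?_, (extendHom_ofCc hD f).symm⟩
    obtain ⟨x, -, rfl⟩ := f.hasCompactSupport.tsupport_extend_zero_subset continuous_val hg
    exact x.mem
  · refine closure_minimal ?_ (isClosed_range_extendHom hD)
    rintro _ ⟨f, hf, rfl⟩
    have hfr : tsupport f ⊆ Set.range (val : Reduction D → G) := by rw [range_val]; exact hf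
    let f' : C_c(Reduction D, ℂ) :=
      { toFun := fun g => f g.val
        continuous_toFun := f.continuous.comp continuous_val
        hasCompactSupport' := by
          -- The inclusion is not a closed embedding, but the support of `f` lies in its range, so
          -- the preimage of this compact set is still compact.
          refine (isEmbedding_val.isInducing.isCompact_preimage' f.hasCompactSupport.isCompact
            hfr).of_isClosed_subset (isClosed_tsupport _) ?_
          exact closure_minimal (fun g hg => subset_tsupport _ hg)
            ((isClosed_tsupport _).preimage continuous_val) }
    refine ⟨ofCc f', ?_⟩
    rw [extendHom_ofCc]
    congr 1
    ext g
    by_cases hg : g ∈ Set.range (val : Reduction D → G)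
    · obtain ⟨g, rfl⟩ := hg
      exact extendByZero_apply _ f' g
    · rw [extendByZero_apply_notMem _ _ hg, image_eq_zero_of_notMem_tsupport fun h => hg (hfr h)]

variable [LocallyCompactSpace G]

/-- By Tietze every function in `C_c(G_D)` is a restriction, so the range is dense, and dense range
suffices for C*-algebras. -/
lemma restrictHom_surjective (hD : IsClosed D.carrier) : Function.Surjective (restrictHom hD) := by
  refine NonUnitalStarAlgHom.surjective_of_denseRange _ ?_
  refine (denseRange_ofCc (G := Reduction D)).mono ?_
  rintro _ ⟨f, rfl⟩
  obtain ⟨F, hF⟩ := f.exists_extension (isClosedEmbedding_val hD)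
  refine ⟨ofCc F, ?_⟩
  rw [restrictHom_ofCc]
  congr 1
  ext g
  exact hF g

/-- Restriction `C₀(G⁽⁰⁾) → C₀(D)` for closed `D`. -/
noncomputable def restrictC0 (hD : IsClosed D.carrier) (f : C₀(UnitSpace G, ℂ)) :
    C₀(UnitSpace (Reduction D), ℂ) where
  toFun v := f (unitIncl v)
  continuous_toFun := f.continuous.comp isEmbedding_unitIncl.continuous
  zero_at_infty' := (zero_at_infty f).comp (isClosedEmbedding_unitIncl hD).tendsto_cocompact

lemma restrictHom_ofC0 (hD : IsClosed D.carrier) (f : C₀(UnitSpace G, ℂ)) :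
    restrictHom hD (ofC0 f) = ofC0 (restrictC0 hD f) := by
  apply Subtype.ext
  refine OpAlg.ext fun v => ?_
  ext ξ i
  change conjReindex (fibEquiv (v := v) rfl).symm ((diagOps f).proj (unitIncl v)) ξ i =
    (diagOps (restrictC0 hD f)).proj v ξ i
  rw [conjReindex_apply, diagOps_apply, diagOps_apply]
  change f (r i.1.val) * _ = f (unitIncl (r i.1)) * _
  rw [unitIncl_r]
  rfl

end Reduction

open Reduction

/-! ### Separation of ideals, inner exactness and the residual intersection property -/

section Equivalence

variable {G : Type u} [TopologicalSpace G] [EtaleGroupoid G]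

/-- The smallest open invariant set that contains a given open set. -/
def saturation (V : Set (UnitSpace G)) (hV : IsOpen V) : InvariantOpens G :=
  ⟨⟨r '' (d ⁻¹' V), by
    have : r '' (d ⁻¹' V) = Subtype.val ⁻¹' ((fun g : G => (r g : G)) '' (d ⁻¹' V)) := by
      ext u
      simp [Subtype.ext_iff]
    rw [this]
    exact (isLocalHomeomorph_r.isOpenMap _ (hV.preimage continuous_d)).preimage
      continuous_subtype_val⟩, by
    rintro g ⟨h, hh, e⟩
    have c : Comp g h := comp_iff.2 e.symm
    exact ⟨mul g h c, by rwa [mem_preimage, d_mul], r_mul g h c⟩⟩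

lemma saturation_le_iff {V : Set (UnitSpace G)} {hV : IsOpen V} {U : InvariantOpens G} :
    saturation V hV ≤ U ↔ V ⊆ U.1 := by
  constructor
  · intro h u hu
    exact h ⟨(u : G), by rwa [mem_preimage, d_coe_unit], r_coe_unit u⟩
  · rintro h _ ⟨g, hg, rfl⟩
    exact U.2 g (h hg)

variable [T2Space G]

/-- The complement of a closed invariant set. -/
def InvariantOpens.complOfClosed (D : Set (UnitSpace G)) (hD : IsClosed D) (hi : IsInvariant D) :
    InvariantOpens G := ⟨⟨Dᶜ, hD.isOpen_compl⟩, hi.compl⟩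

lemma restrictHom_eq_zero_iff_mem {D : Set (UnitSpace G)} (hD : IsClosed D) (hi : IsInvariant D)
    {a : ReducedCStar G} : restrictHom (D := LCInvariant.ofClosed D hD hi) hD a = 0 ↔
      a ∈ vanishingIdeal (InvariantOpens.complOfClosed D hD hi) := by
  refine (restrictHom_eq_zero_iff (D := LCInvariant.ofClosed D hD hi) hD).trans ?_
  rw [mem_vanishingIdeal]
  exact forall_congr' fun u => by
    change (u ∈ D → _) ↔ (¬ u ∈ Dᶜ → _)
    rw [notMem_compl_iff]

/-- Together with `restrictHom_eq_zero_iff_mem` this turns exactness in the middle into the equality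
of the supported and the vanishing ideal of the complement of `D`. -/
lemma mem_range_extendHom_iff {D : Set (UnitSpace G)} (hD : IsClosed D) (hi : IsInvariant D)
    {a : ReducedCStar G} :
    a ∈ Set.range (extendHom (D := LCInvariant.complOfClosed D hD hi) hD.isOpen_compl) ↔
      a ∈ supportedIdeal (InvariantOpens.complOfClosed D hD hi) :=
  Set.ext_iff.1 (range_extendHom (D := LCInvariant.complOfClosed D hD hi) hD.isOpen_compl) a

variable [LocallyCompactSpace G]

/-- The image of the first map and the kernel of the second are ideals with the same support, so
separation identifies them. -/
lemma SeparatesIdeals.isInnerExact (h : SeparatesIdeals G) : IsInnerExact G := by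
  intro D hD hi
  refine ⟨extendHom_injective _, fun a => ?_, restrictHom_surjective hD⟩
  refine (restrictHom_eq_zero_iff_mem hD hi).trans
    (Iff.trans ?_ (mem_range_extendHom_iff hD hi).symm)
  rw [h ((idealToOpens_supportedIdeal _).trans (idealToOpens_vanishingIdeal _).symm)]

/-- Suppose `J` meets `C₀(D)` only in zero. A function on units in the preimage of `J` then
restricts to zero on `D`, so the preimage has the same support as the kernel of the restriction.
Separation makes the two equal, whence `J` is zero. -/
lemma SeparatesIdeals.hasResidualIntersectionProperty (h : SeparatesIdeals G) :
    HasResidualIntersectionProperty G := by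
  intro D hD hi J hJ
  by_contra! hJ0
  set π := restrictHom (D := LCInvariant.ofClosed D hD hi) hD
  have hI : J.comap π = vanishingIdeal (InvariantOpens.complOfClosed D hD hi) := by
    refine h (le_antisymm ?_ ?_)
    · rw [idealToOpens_vanishingIdeal]
      intro u hu
      obtain ⟨f, hf, hfu⟩ := mem_idealToOpens.1 hu
      let f' := restrictC0 (D := LCInvariant.ofClosed D hD hi) hD f
      have e : π (ofC0 f) = ofC0 f' := restrictHom_ofC0 _ f
      rw [ClosedIdeal.mem_comap, e] at hf
      intro huD
      refine hfu ?_
      have h0 : f' = 0 := by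
        by_contra hne
        exact hJ0 _ hne hf
      have := DFunLike.congr_fun h0 (unitLift u huD)
      exact (congrArg f (unitIncl_unitLift u huD)).symm.trans this
    · refine idealToOpens_mono fun a ha => ?_
      rw [ClosedIdeal.mem_comap, (restrictHom_eq_zero_iff_mem hD hi).2 ha]
      exact Submodule.zero_mem _
  obtain ⟨x, hx, hx0⟩ := hJ
  obtain ⟨a, rfl⟩ := restrictHom_surjective hD x
  have ha : a ∈ J.comap π := hx
  rw [hI, ← restrictHom_eq_zero_iff_mem] at ha
  exact hx0 ha

/-- A non-zero closed ideal that meets `C₀(G⁽⁰⁾)` contains a non-zero compactly supported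
function. -/
lemma exists_compactlySupported_mem {I : ClosedIdeal (ReducedCStar G)} {f : C₀(UnitSpace G, ℂ)}
    (hf : f ≠ 0) (hI : ofC0 f ∈ I) :
    ∃ f' : C_c(UnitSpace G, ℂ), f' ≠ 0 ∧ ofC0 (ofCompactSupport f') ∈ I := by
  obtain ⟨u, hu⟩ : ∃ u, f u ≠ 0 := by
    by_contra! h
    exact hf (ZeroAtInftyContinuousMap.ext h)
  obtain ⟨φ, hφ1, hφ⟩ := exists_compactlySupported_one_of_isCompact (isCompact_singleton (x := u))
    (isOpen_idealSupport I) (singleton_subset_iff.2 (mem_idealSupport.2 ⟨f, hI, hu⟩))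
  refine ⟨φ, fun h0 => ?_, ofC0_mem_of_tsupport_subset hφ⟩
  have := hφ1 u rfl
  rw [h0] at this
  exact zero_ne_one this

/-- Inner exactness yields the inclusion of the vanishing ideal in `I`; the intersection property of
the reduction to the complement `D` of the support yields the other one. -/
lemma eq_vanishingIdeal (he : IsInnerExact G) (hr : HasResidualIntersectionProperty G)
    (I : ClosedIdeal (ReducedCStar G)) : I = vanishingIdeal (idealToOpens I) := by
  set U := idealToOpens I with hU
  set D : Set (UnitSpace G) := (U.1 : Set (UnitSpace G))ᶜ
  have hD : IsClosed D := U.1.isOpen.isClosed_compl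
  have hi : IsInvariant D := IsInvariant.compl U.2
  have hUD : InvariantOpens.complOfClosed D hD hi = U :=
    Subtype.ext (TopologicalSpace.Opens.ext (compl_compl _))
  set π := restrictHom (D := LCInvariant.ofClosed D hD hi) hD
  have hker : ∀ a, π a = 0 ↔ a ∈ vanishingIdeal U := fun a => by
    rw [restrictHom_eq_zero_iff_mem, hUD]
  -- The kernel of the restriction is the closure of `C_c(G_U)`, which every ideal with support `U`
  -- contains.
  have hle : vanishingIdeal U ≤ I := by
    intro a ha
    obtain ⟨-, hex, -⟩ := he D hD hi
    have h1 := (mem_range_extendHom_iff hD hi).1 ((hex a).1 ((hker a).2 ha))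
    refine supportedIdeal_le_of_le ?_ h1
    exact hUD.le
  refine le_antisymm (fun a ha => ?_) hle
  by_contra hne
  have hI : ∀ a, π a = 0 → a ∈ I := fun a h => hle ((hker a).1 h)
  obtain ⟨f, hf, hfI⟩ := hr D hD hi (I.map π (restrictHom_surjective hD) hI)
    ⟨π a, ⟨a, ha, rfl⟩, fun h => hne ((hker a).1 h)⟩
  -- Passing to compact support makes the Tietze extension from `D` to `G⁽⁰⁾` available.
  obtain ⟨f, hf, hfI⟩ := exists_compactlySupported_mem hf hfI
  obtain ⟨F, hF⟩ := f.exists_extension (isClosedEmbedding_unitIncl hD)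
  have h1 : π (ofC0 (ofCompactSupport F)) = ofC0 (ofCompactSupport f) := by
    refine (restrictHom_ofC0 (D := LCInvariant.ofClosed D hD hi) hD _).trans (congrArg ofC0 ?_)
    ext v
    exact hF v
  -- Since `I` contains the kernel, the extension `F` itself lies in `I`. So `F` must vanish on `D`,
  -- which is disjoint from the support of `I`.
  rw [← h1, ClosedIdeal.apply_mem_map_iff] at hfI
  refine hf (CompactlySupportedContinuousMap.ext fun v => ?_)
  by_contra hv
  rw [← hF v] at hv
  have h2 : unitIncl v ∈ (idealToOpens I).1 := mem_idealToOpens.2 ⟨_, hfI, hv⟩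
  exact unitIncl_mem v h2

lemma separatesIdeals_iff :
    SeparatesIdeals G ↔ IsInnerExact G ∧ HasResidualIntersectionProperty G :=
  ⟨fun h => ⟨h.isInnerExact, h.hasResidualIntersectionProperty⟩, fun h I J e => by
    rw [eq_vanishingIdeal h.1 h.2 I, eq_vanishingIdeal h.1 h.2 J, e]⟩

/-! ### The lattice isomorphism and the Fell topology -/

lemma SeparatesIdeals.vanishingIdeal_idealToOpens (h : SeparatesIdeals G)
    (I : ClosedIdeal (ReducedCStar G)) : vanishingIdeal (idealToOpens I) = I :=
  h (idealToOpens_vanishingIdeal _)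

/-- If `C₀(G⁽⁰⁾)` separates ideals, then `I ↦ U_I` is an isomorphism of ordered sets. -/
noncomputable def SeparatesIdeals.orderIso (h : SeparatesIdeals G) :
    ClosedIdeal (ReducedCStar G) ≃o InvariantOpens G where
  toFun := idealToOpens
  invFun := vanishingIdeal
  left_inv := h.vanishingIdeal_idealToOpens
  right_inv := idealToOpens_vanishingIdeal
  map_rel_iff' {I J} := by
    refine ⟨fun hIJ => ?_, fun hIJ => idealToOpens_mono hIJ⟩
    rw [← h.vanishingIdeal_idealToOpens I, ← h.vanishingIdeal_idealToOpens J]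
    exact vanishingIdeal_mono hIJ

lemma le_ofOpens_iff {X : Type u} [TopologicalSpace X] {J : ClosedIdeal C₀(X, ℂ)}
    {U : TopologicalSpace.Opens X} :
    J ≤ ClosedIdeal.ofOpens U ↔ (⋃ f ∈ J, {x | f x ≠ 0}) ⊆ U := by
  rw [iUnion₂_subset_iff]
  refine forall₂_congr fun f _ => ?_
  exact forall_congr' fun x => not_imp_comm

lemma ofOpens_le_ofOpens_iff {X : Type u} [TopologicalSpace X] [T2Space X] [LocallyCompactSpace X]
    {U V : TopologicalSpace.Opens X} :
    ClosedIdeal.ofOpens U ≤ ClosedIdeal.ofOpens V ↔ U ≤ V := by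
  refine ⟨fun h x hx => ?_, fun h f hf x hx => hf x fun hx' => hx (h hx')⟩
  obtain ⟨φ, hφ1, hφ⟩ := exists_compactlySupported_one_of_isCompact (isCompact_singleton (x := x))
    U.isOpen (singleton_subset_iff.2 hx)
  by_contra hxV
  have h1 : ofCompactSupport φ ∈ ClosedIdeal.ofOpens U := fun y hy =>
    image_eq_zero_of_notMem_tsupport fun h => hy (hφ h)
  have h2 : φ x = 0 := h h1 x hxV
  rw [hφ1 x rfl] at h2
  exact one_ne_zero h2

/-- Let `V` be the open support of an ideal `J` of `C₀(G⁽⁰⁾)`. As `Θ(I)` is invariant, `J ≤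
C₀(Θ(I))` holds exactly when the saturation of `V` lies in `Θ(I)`, that is, when its vanishing ideal
lies in `I`. So preimages of subbasic sets are subbasic. -/
lemma SeparatesIdeals.continuous_idealToOpens (h : SeparatesIdeals G) :
    Continuous (idealToOpens : ClosedIdeal (ReducedCStar G) → InvariantOpens G) := by
  rw [continuous_induced_rng, continuous_generateFrom_iff]
  rintro _ ⟨J, rfl⟩
  have hV : IsOpen (⋃ f ∈ J, {x : UnitSpace G | f x ≠ 0}) :=
    isOpen_biUnion fun f _ => isOpen_ne.preimage f.continuous
  refine TopologicalSpace.isOpen_generateFrom_of_mem ⟨vanishingIdeal (saturation _ hV), ?_⟩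
  ext I
  change ¬ J ≤ ClosedIdeal.ofOpens (idealToOpens I).1 ↔ ¬ vanishingIdeal (saturation _ hV) ≤ I
  rw [le_ofOpens_iff, ← saturation_le_iff (hV := hV)]
  exact not_congr (h.orderIso.symm_apply_le (y := saturation _ hV) (x := I)).symm

/-- The relation `I ≤ vanishingIdeal U` is equivalent to `C₀(Θ(I)) ≤ C₀(U)`, so the subbasic set of
`I` pulls back to that of `C₀(Θ(I))`. -/
lemma SeparatesIdeals.continuous_vanishingIdeal (h : SeparatesIdeals G) :
    Continuous (vanishingIdeal : InvariantOpens G → ClosedIdeal (ReducedCStar G)) := by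
  rw [continuous_generateFrom_iff]
  rintro _ ⟨I, rfl⟩
  refine isOpen_induced_iff.2 ⟨_, TopologicalSpace.isOpen_generateFrom_of_mem
    ⟨ClosedIdeal.ofOpens (idealToOpens I).1, rfl⟩, ?_⟩
  ext U
  change ¬ ClosedIdeal.ofOpens (idealToOpens I).1 ≤ ClosedIdeal.ofOpens U.1 ↔
    ¬ I ≤ vanishingIdeal U
  rw [ofOpens_le_ofOpens_iff]
  exact not_congr (h.orderIso.le_symm_apply (y := U) (x := I)).symm

lemma SeparatesIdeals.isHomeomorph (h : SeparatesIdeals G) :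
    IsHomeomorph (idealToOpens : ClosedIdeal (ReducedCStar G) → InvariantOpens G) :=
  isHomeomorph_iff_exists_inverse.2 ⟨h.continuous_idealToOpens, vanishingIdeal,
    h.vanishingIdeal_idealToOpens, idealToOpens_vanishingIdeal, h.continuous_vanishingIdeal⟩

end Equivalence

end EtaleGroupoid

theorem mainTheorem1 {G : Type u} [TopologicalSpace G] [LocallyCompactSpace G] [T2Space G]
    [EtaleGroupoid G] :
    List.TFAE
      [Function.Bijective
        (EtaleGroupoid.idealToOpens :
          ClosedIdeal (EtaleGroupoid.ReducedCStar G) → EtaleGroupoid.InvariantOpens G),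
       EtaleGroupoid.SeparatesIdeals G,
       EtaleGroupoid.IsInnerExact G ∧ EtaleGroupoid.HasResidualIntersectionProperty G] ∧
    (Function.Bijective
        (EtaleGroupoid.idealToOpens :
          ClosedIdeal (EtaleGroupoid.ReducedCStar G) → EtaleGroupoid.InvariantOpens G) →
      (∀ I J : ClosedIdeal (EtaleGroupoid.ReducedCStar G),
        EtaleGroupoid.idealToOpens (I ⊓ J) =
            EtaleGroupoid.idealToOpens I ⊓ EtaleGroupoid.idealToOpens J ∧
          EtaleGroupoid.idealToOpens (I ⊔ J) =
            EtaleGroupoid.idealToOpens I ⊔ EtaleGroupoid.idealToOpens J) ∧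
      IsHomeomorph
        (EtaleGroupoid.idealToOpens :
          ClosedIdeal (EtaleGroupoid.ReducedCStar G) → EtaleGroupoid.InvariantOpens G)) := by
  constructor
  · tfae_have 1 → 2 := fun h => h.1
    tfae_have 2 → 1 := fun h => ⟨h, EtaleGroupoid.idealToOpens_surjective⟩
    tfae_have 2 ↔ 3 := EtaleGroupoid.separatesIdeals_iff
    tfae_finish
  · intro hb
    have h : EtaleGroupoid.SeparatesIdeals G := hb.1
    exact ⟨fun I J => ⟨h.orderIso.map_inf I J, h.orderIso.map_sup I J⟩, h.isHomeomorph⟩
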